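/- A triangulated closed oriented surface of genus $g$ is a finite connected simplicial complex of dimension at most two in which the link of every vertex is a cycle, with Euler characteristic $2-2g$, together with a coherent orientation of its triangles. Let $\mathbb{T}^2$ be the 7-vertex triangulation of the torus with vertices $v_1,\dots,v_7$ and the triangles $v_1v_2v_4$, $v_2v_4v_5$, $v_2v_3v_5$, $v_3v_5v_6$, $v_1v_5v_6$, $v_1v_2v_6$, $v_2v_6v_7$, $v_2v_3v_7$, $v_1v_3v_7$, $v_1v_5v_7$, $v_4v_5v_7$, $v_4v_6v_7$, $v_3v_4v_6$, $v_1v_3v_4$, oriented so that $[v_1v_2v_4]$ is positive. A simplicial map $f\colon K\to\mathbb{T}^2$ from a triangulated closed oriented surface has degree $d$ if $f_*[K]=d\,[\mathbb{T}^2]$ in $H_2(\mathbb{T}^2;\mathbb{Z})$. Such a map $f$ of degree $d$, with $K$ of genus $g$, is called minimal if no triangulated closed oriented surface of genus $g$ with fewer vertices than $K$ admits a simplicial map of degree $d$ to $\mathbb{T}^2$. For $g=1$ and for $g=2$, and for every integer $d$, there is a minimal simplicial map of degree $d$ from a triangulated closed oriented surface $K$ of genus $g$ to $\mathbb{T}^2$.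 The number $n$ of vertices of $K$ is then as follows. (1) If $g=1$, then $n=7|d|$ for $d\neq 0$, and $n=7$ for $d=0$. (2) If $g=2$, then $n=7|d|-2$ for $|d|\geq 3$, $n=13$ for $|d|=2$, and $n=10$ for $|d|\leq 1$. -/

import Mathlib

/-- Three vertices of an abstract simplicial complex span a triangle (a face with exactly
three vertices). -/
def AbstractSimplicialComplex.IsTriangle {V : Type*} [DecidableEq V]
    (K : AbstractSimplicialComplex V) (u v w : V) : Prop :=
  u ≠ v ∧ v ≠ w ∧ u ≠ w ∧ {u, v, w} ∈ K.faces

/-- The graph formed by the vertices and the edges of an abstract simplicial complex. -/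
def AbstractSimplicialComplex.edgeGraph {V : Type*} [DecidableEq V]
    (K : AbstractSimplicialComplex V) : SimpleGraph V where
  Adj u v := u ≠ v ∧ {u, v} ∈ K.faces
  symm := ⟨fun u v h => ⟨h.1.symm, by rw [Finset.pair_comm]; exact h.2⟩⟩
  loopless := ⟨fun _ h => h.1 rfl⟩

/-- The link of a vertex `v` in a complex of dimension at most two, as a graph: its vertices are
the neighbours of `v`, and two neighbours are joined when they span a triangle with `v`. -/
def AbstractSimplicialComplex.linkGraph {V : Type*} [DecidableEq V]
    (K : AbstractSimplicialComplex V) (v : V) : SimpleGraph (K.edgeGraph.neighborSet v) where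
  Adj a b := K.IsTriangle v a b
  symm := ⟨fun a b h => ⟨h.2.2.1, h.2.1.symm, h.1, by
    rw [Finset.pair_comm]; exact h.2.2.2⟩⟩
  loopless := ⟨fun _ h => h.2.1 rfl⟩

/-- A triangulated connected closed surface: a connected simplicial complex of dimension at most
two in which the link of every vertex is a cycle. (The vertex set of the complex is all of the
finite type `V`, because an `AbstractSimplicialComplex` contains all singletons. Since links
are cycles, every face lies in a triangle.) -/
structure AbstractSimplicialComplex.IsClosedSurface {V : Type*} [Fintype V] [DecidableEq V]
    (K : AbstractSimplicialComplex V) : Prop where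
  card_le : ∀ s ∈ K.faces, s.card ≤ 3
  connected : K.edgeGraph.Connected
  link_cycle : ∀ v : V, ∃ n : ℕ, 3 ≤ n ∧ Nonempty (K.linkGraph v ≃g SimpleGraph.cycleGraph n)

/-- The Euler characteristic of a two-dimensional complex: the number of vertices, minus the
number of edges, plus the number of triangles. -/
noncomputable def AbstractSimplicialComplex.eulerChar₂ {V : Type*}
    (K : AbstractSimplicialComplex V) : ℤ :=
  ({s ∈ K.faces | s.card = 1}.ncard : ℤ) - ({s ∈ K.faces | s.card = 2}.ncard : ℤ)
    + ({s ∈ K.faces | s.card = 3}.ncard : ℤ)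

/-- A triangulated connected closed surface together with a coherent orientation. The number
`sign u v w` is `1` or `-1` if `[u v w]`, with its vertices in this order, is a positively or a
negatively oriented triangle, and `0` if `u, v, w` do not span a triangle. The orientation is
reversed by an odd permutation of the vertices, and two distinct triangles `[u v w]`, `[u v w']`
that share the edge `uv` have opposite signs with respect to these orderings. -/
structure OrientedTriangulatedSurface (V : Type*) [Fintype V] [DecidableEq V] where
  complex : AbstractSimplicialComplex V
  isClosedSurface : complex.IsClosedSurface
  sign : V → V → V → ℤ
  sign_of_isTriangle : ∀ u v w, complex.IsTriangle u v w → sign u v w = 1 ∨ sign u v w = -1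
  sign_of_not_isTriangle : ∀ u v w, ¬ complex.IsTriangle u v w → sign u v w = 0
  sign_swap_left : ∀ u v w, sign v u w = -sign u v w
  sign_swap_right : ∀ u v w, sign u w v = -sign u v w
  coherent : ∀ u v w w', w ≠ w' → complex.IsTriangle u v w → complex.IsTriangle u v w' →
    sign u v w' = -sign u v w

/-- The surface has genus `g`: it is connected, closed and orientable with Euler characteristic
`2 - 2g`. -/
def OrientedTriangulatedSurface.HasGenus {V : Type*} [Fintype V] [DecidableEq V]
    (K : OrientedTriangulatedSurface V) (g : ℕ) : Prop :=
  K.complex.eulerChar₂ = 2 - 2 * (g : ℤ)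

/-- A map of vertices is a simplicial map if it sends every simplex to a simplex (possibly of
smaller dimension). -/
def IsSimplicialMap {V W : Type*} [DecidableEq W]
    (K : AbstractSimplicialComplex V) (L : AbstractSimplicialComplex W) (f : V → W) : Prop :=
  ∀ s ∈ K.faces, s.image f ∈ L.faces

/-- The map induced by a vertex map on simplicial 2-chains with integer coefficients. A 2-chain is
written as the alternating function `c` for which `c u v w` is the coefficient of the ordered
simplex `[u v w]`; the induced map sends `[u v w]` to `[f(u) f(v) f(w)]`, which is zero when two of
the images agree (here the terms with two vertices exchanged cancel). -/
def chainMap₂ {V W : Type*} [Fintype V] [DecidableEq W] (f : V → W) (c : V → V → V → ℤ) :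
    W → W → W → ℤ :=
  fun x y z => ∑ u : V, ∑ v : V, ∑ w : V,
    if f u = x ∧ f v = y ∧ f w = z then c u v w else 0

/-- The simplicial map `f` has degree `d`: `f_*[K] = d • [L]` in `H₂(L; ℤ)`. The fundamental class
of an oriented surface is the sum of its positive triangles minus the sum of its negative
triangles, that is, the 2-cycle `sign`. As a surface has no 3-simplices, a class in `H₂` is the same
thing as a 2-cycle, so that the identity is one between 2-chains. -/
def HasDegree {V W : Type*} [Fintype V] [DecidableEq V] [Fintype W] [DecidableEq W]
    (K : OrientedTriangulatedSurface V) (L : OrientedTriangulatedSurface W)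
    (f : V → W) (d : ℤ) : Prop :=
  chainMap₂ f K.sign = d • L.sign

/-- The 14 triangles of the 7-vertex torus, each in its positive order, where `[v₁ v₂ v₄]` is
positive; the vertices `v₁, …, v₇` are written `0, …, 6`. -/
def torusTriangles : List (Fin 7 × Fin 7 × Fin 7) :=
  [(0, 1, 3), (1, 4, 3), (1, 2, 4), (2, 5, 4), (0, 4, 5), (0, 5, 1), (1, 5, 6),
   (1, 6, 2), (0, 2, 6), (0, 6, 4), (3, 4, 6), (3, 6, 5), (2, 3, 5), (0, 3, 2)]

/-- The 7-vertex torus as an abstract simplicial complex: the nonempty subsets of its triangles. -/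
def torusComplex : AbstractSimplicialComplex (Fin 7) where
  faces := {s | s.Nonempty ∧ ∃ t ∈ torusTriangles, s ⊆ {t.1, t.2.1, t.2.2}}
  isRelLowerSet_faces := fun _ hs =>
    ⟨hs.1, fun _ hts ht => ⟨ht, hs.2.imp fun _ h => ⟨h.1, hts.trans h.2⟩⟩⟩
  singleton_mem := fun v => ⟨Finset.singleton_nonempty v, by revert v; decide⟩

/-- `[u v w]` is a positively oriented triangle of the 7-vertex torus. -/
def TorusPositive (u v w : Fin 7) : Prop :=
  (u, v, w) ∈ torusTriangles ∨ (v, w, u) ∈ torusTriangles ∨ (w, u, v) ∈ torusTriangles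

instance (u v w : Fin 7) : Decidable (TorusPositive u v w) := by
  unfold TorusPositive; infer_instance

instance (s : Finset (Fin 7)) : Decidable (s ∈ torusComplex.faces) :=
  inferInstanceAs (Decidable (s.Nonempty ∧ ∃ t ∈ torusTriangles, s ⊆ {t.1, t.2.1, t.2.2}))

theorem torusComplex_isTriangle_iff (u v w : Fin 7) :
    torusComplex.IsTriangle u v w ↔ TorusPositive u v w ∨ TorusPositive v u w := by
  have h : ∀ u v w : Fin 7, (u ≠ v ∧ v ≠ w ∧ u ≠ w ∧ {u, v, w} ∈ torusComplex.faces) ↔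
    TorusPositive u v w ∨ TorusPositive v u w := by decide +kernel
  exact h u v w

/-- The cyclic order of the neighbours of a vertex of the 7-vertex torus, relative to the vertex. -/
def torusLinkOrder : Fin 6 → Fin 7 := ![1, 3, 2, 6, 4, 5]

theorem torusComplex_isClosedSurface : torusComplex.IsClosedSurface where
  card_le := by
    rintro s ⟨-, t, -, h⟩
    exact (Finset.card_le_card h).trans Finset.card_le_three
  connected := by
    have h : ∀ u v : Fin 7, u ≠ v → ({u, v} : Finset (Fin 7)) ∈ torusComplex.faces := by
      decide +kernel
    have : torusComplex.edgeGraph = ⊤ := by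
      ext u v
      exact ⟨fun h => h.1, fun huv => ⟨huv, h u v huv⟩⟩
    rw [this]
    exact SimpleGraph.connected_top
  link_cycle := by
    intro v
    refine ⟨6, by norm_num, ⟨RelIso.symm ⟨Equiv.ofBijective
      (fun i => ⟨v + torusLinkOrder i, ?_⟩) ⟨?_, ?_⟩, ?_⟩⟩⟩
    · have h : ∀ (v : Fin 7) (i : Fin 6), v ≠ v + torusLinkOrder i ∧
        {v, v + torusLinkOrder i} ∈ torusComplex.faces := by decide +kernel
      exact h v i
    · have h : ∀ (v : Fin 7) (i j : Fin 6),
        v + torusLinkOrder i = v + torusLinkOrder j → i = j := by decide +kernel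
      exact fun i j hij => h v i j (congrArg Subtype.val hij)
    · have h : ∀ v w : Fin 7, v ≠ w → ∃ i, v + torusLinkOrder i = w := by decide +kernel
      rintro ⟨w, hw⟩
      exact (h v w hw.1).imp fun i hi => Subtype.ext hi
    · have h : ∀ (v : Fin 7) (i j : Fin 6),
        (TorusPositive v (v + torusLinkOrder i) (v + torusLinkOrder j) ∨
          TorusPositive (v + torusLinkOrder i) v (v + torusLinkOrder j)) ↔
        (SimpleGraph.cycleGraph 6).Adj i j := by decide +kernel
      exact fun {i j} => (torusComplex_isTriangle_iff _ _ _).trans (h v i j)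

/-- The 7-vertex torus, oriented so that `[v₁ v₂ v₄]` is positive. -/
def torus₇ : OrientedTriangulatedSurface (Fin 7) where
  complex := torusComplex
  isClosedSurface := torusComplex_isClosedSurface
  sign u v w := if TorusPositive u v w then 1 else if TorusPositive v u w then -1 else 0
  sign_of_isTriangle u v w h := by
    rw [torusComplex_isTriangle_iff] at h
    split_ifs <;> simp_all
  sign_of_not_isTriangle u v w h := by
    rw [torusComplex_isTriangle_iff] at h
    split_ifs <;> simp_all
  sign_swap_left := by decide +kernel
  sign_swap_right := by decide +kernel
  coherent := by
    simp only [torusComplex_isTriangle_iff]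
    decide +kernel

/-- Among all simplicial maps of degree `d` from triangulated oriented surfaces of genus `g` to the
7-vertex torus, `f` is one whose domain has the smallest number of vertices. -/
def IsMinimalDegreeMap (g : ℕ) (d : ℤ) {V : Type} [Fintype V] [DecidableEq V]
    (K : OrientedTriangulatedSurface V) (f : V → Fin 7) : Prop :=
  K.HasGenus g ∧ IsSimplicialMap K.complex torus₇.complex f ∧ HasDegree K torus₇ f d ∧
    ∀ (V' : Type) [Fintype V'] [DecidableEq V'] (K' : OrientedTriangulatedSurface V')
      (f' : V' → Fin 7), K'.HasGenus g → IsSimplicialMap K'.complex torus₇.complex f' →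
      HasDegree K' torus₇ f' d → Fintype.card V ≤ Fintype.card V'

/-! Lower bounds come from counting. In a closed oriented surface with `n` vertices every directed
edge lies in exactly one positive triangle, so the vertex degrees sum to three times the number of
triangles, which is `6n - 12 + 12g` by Euler's formula. A map of degree `d` covers each of the six
triangles at a vertex of the torus at least `|d|` times, so the degrees in each of the seven fibres
sum to at least `6|d|` (`six_mul_natAbs_le`). Together this gives `42|d| ≤ 6n - 12 + 12g`, that is
`n ≥ 7|d|` for genus one and `n ≥ 7|d| - 2` for genus two.

Small degrees need more. A degree is at most `n - 1`, which forces `n ≥ 7` for genus one and `n ≥ 9`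
for genus two. Nine vertices are excluded by a verified search (`refute_star`, `Model.not_star`).
For `|d| = 2` at most twelve vertices would leave some fibre a single point, whose degree would have
to be at least twelve (`thirteen_le_card`).

Upper bounds come from constructions, all given by cyclic lists of neighbours. For genus one, the
torus on `ZMod (7d)` with a cyclic symmetry covers the 7-vertex torus, which is its case `d = 1`.
For genus two and `d ≥ 3`, the cyclic torus on `7(d - 1)` vertices and a 7-vertex torus are cut
along a path of two edges and glued crosswise. The result is a branched cover with two branch
points, the ends of the path; identifying these saves two vertices. For `d = 2` both tori contain
the edge between the two ends, so one copy has to be subdivided. Degrees zero and one use an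
explicit surface with ten vertices. Negative degrees follow by reversing the orientation. -/

/-! ### Cyclic lists -/

/-- The pairs of cyclically consecutive entries of a list. -/
def cycPairs {α : Type*} (l : List α) : List (α × α) := l.zip (l.rotate 1)

section CycPairs

variable {α β : Type*}

theorem mem_cycPairs {l : List α} {a b : α} :
    (a, b) ∈ cycPairs l ↔
      ∃ (i : ℕ) (h : i < l.length), l[i] = a ∧
        l[(i + 1) % l.length]'(Nat.mod_lt _ (by omega)) = b := by
  simp only [cycPairs, List.mem_iff_getElem, List.getElem_zip, List.length_zip,
    List.length_rotate, min_self, List.getElem_rotate, Prod.mk.injEq]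

theorem cycPairs_map (f : α → β) (l : List α) :
    cycPairs (l.map f) = (cycPairs l).map (Prod.map f f) := by
  simp [cycPairs, ← List.map_rotate, List.zip_map]

theorem nodup_cycPairs {l : List α} (h : l.Nodup) : (cycPairs l).Nodup := by
  refine List.Nodup.of_map Prod.fst ?_
  rw [cycPairs, List.map_fst_zip (by simp)]
  exact h

theorem fst_mem_of_mem_cycPairs {l : List α} {p : α × α} (h : p ∈ cycPairs l) : p.1 ∈ l :=
  (List.of_mem_zip h).1

theorem snd_mem_of_mem_cycPairs {l : List α} {p : α × α} (h : p ∈ cycPairs l) : p.2 ∈ l :=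
  List.mem_rotate.1 (List.of_mem_zip (a := p.1) (b := p.2) h).2

theorem exists_mem_cycPairs {l : List α} {a : α} (h : a ∈ l) : ∃ b, (a, b) ∈ cycPairs l := by
  obtain ⟨i, hi, rfl⟩ := List.mem_iff_getElem.1 h
  exact ⟨_, mem_cycPairs.2 ⟨i, hi, rfl, rfl⟩⟩

theorem cycPairs_right_unique {l : List α} (hl : l.Nodup) {a b c : α}
    (hb : (a, b) ∈ cycPairs l) (hc : (a, c) ∈ cycPairs l) : b = c := by
  obtain ⟨i, hi, rfl, rfl⟩ := mem_cycPairs.1 hb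
  obtain ⟨j, hj, h, rfl⟩ := mem_cycPairs.1 hc
  obtain rfl : j = i := (hl.getElem_inj_iff).1 h
  rfl

/-- Two steps forward return to the start only in a cycle of length at most two. For rotation
systems this says that no triangle is both positive and negative. -/
theorem cycPairs_asymm {l : List α} (hl : l.Nodup) (h3 : 3 ≤ l.length) {a b : α}
    (hab : (a, b) ∈ cycPairs l) : (b, a) ∉ cycPairs l := by
  intro hba
  obtain ⟨i, hi, rfl, rfl⟩ := mem_cycPairs.1 hab
  obtain ⟨j, hj, h, h'⟩ := mem_cycPairs.1 hba
  rw [hl.getElem_inj_iff] at h h'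
  subst h
  rcases Nat.lt_or_ge (i + 1) l.length with h1 | h1
  · rw [Nat.mod_eq_of_lt h1] at h'
    rcases Nat.lt_or_ge (i + 2) l.length with h2 | h2
    · rw [Nat.mod_eq_of_lt h2] at h'
      omega
    · rw [show i + 1 + 1 = l.length by omega, Nat.mod_self] at h'
      omega
  · rw [show i + 1 = l.length by omega, Nat.mod_self, Nat.zero_add,
      Nat.mod_eq_of_lt (by omega)] at h'
    omega

theorem cycPairs_ne {l : List α} (hl : l.Nodup) (h3 : 3 ≤ l.length) {a b : α}
    (hab : (a, b) ∈ cycPairs l) : a ≠ b := by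
  rintro rfl
  exact cycPairs_asymm hl h3 hab hab

theorem cycleGraph_adj_iff_mod {n : ℕ} (hn : 3 ≤ n) (i j : Fin n) :
    (SimpleGraph.cycleGraph n).Adj i j ↔ (i + 1) % n = j.1 ∨ (j + 1) % n = i.1 := by
  rw [SimpleGraph.cycleGraph_adj']
  have key : ∀ x y : Fin n, (x - y).1 = 1 ↔ (y + 1) % n = x.1 := by
    intro x y
    rw [Fin.sub_def]
    simp only
    have hx := x.2
    have hy := y.2
    rcases Nat.lt_or_ge x.1 y.1 with h | h
    · rw [Nat.mod_eq_of_lt (by omega)]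
      rcases Nat.lt_or_ge (y.1 + 1) n with h' | h'
      · rw [Nat.mod_eq_of_lt h']; omega
      · rw [show y.1 + 1 = n by omega, Nat.mod_self]; omega
    · rw [show n - y.1 + x.1 = n + (x.1 - y.1) by omega, Nat.add_mod_left,
        Nat.mod_eq_of_lt (by omega)]
      rcases Nat.lt_or_ge (y.1 + 1) n with h' | h'
      · rw [Nat.mod_eq_of_lt h']; omega
      · rw [show y.1 + 1 = n by omega, Nat.mod_self]; omega
  rw [key, key, or_comm]

end CycPairs

/-! ### Surfaces from rotation systems -/

/-- A rotation system on `V`: at every vertex the cyclic list of its neighbours, so that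
`[v a b]` is a positive triangle when `b` follows `a` in the list at `v`. Connectivity is witnessed
by a rank function that can be decreased along an edge away from the root. -/
structure RotationSystem (V : Type*) where
  link : V → List V
  nodup : ∀ v, (link v).Nodup
  three_le : ∀ v, 3 ≤ (link v).length
  not_mem : ∀ v, v ∉ link v
  rot : ∀ v, ∀ p ∈ cycPairs (link v), (p.2, v) ∈ cycPairs (link p.1)
  root : V
  rank : V → ℕ
  exists_lower : ∀ v, v ≠ root → ∃ w ∈ link v, rank w < rank v

namespace RotationSystem

variable {V : Type*} (R : RotationSystem V)

/-- `[v a b]` is a positive triangle. -/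
def Pos (v a b : V) : Prop := (a, b) ∈ cycPairs (R.link v)

variable {R} {v a b c : V}

theorem Pos.rot (h : R.Pos v a b) : R.Pos a b v := R.rot v (a, b) h

theorem Pos.mem_left (h : R.Pos v a b) : a ∈ R.link v := fst_mem_of_mem_cycPairs h

theorem Pos.mem_right (h : R.Pos v a b) : b ∈ R.link v := snd_mem_of_mem_cycPairs h

theorem Pos.ne_left (h : R.Pos v a b) : v ≠ a := by
  rintro rfl
  exact R.not_mem _ h.mem_left

theorem Pos.ne_right (h : R.Pos v a b) : a ≠ b := cycPairs_ne (R.nodup v) (R.three_le v) h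

theorem Pos.ne (h : R.Pos v a b) : v ≠ b := by
  rintro rfl
  exact R.not_mem _ h.mem_right

theorem Pos.not_swap (h : R.Pos v a b) : ¬ R.Pos v b a :=
  cycPairs_asymm (R.nodup v) (R.three_le v) h

theorem Pos.not_swap_left (h : R.Pos v a b) : ¬ R.Pos a v b :=
  fun h' => h.rot.not_swap h'

theorem Pos.unique (h : R.Pos v a b) (h' : R.Pos v a c) : b = c :=
  cycPairs_right_unique (R.nodup v) h h'

theorem exists_pos (h : a ∈ R.link v) : ∃ b, R.Pos v a b := exists_mem_cycPairs h

variable (R) in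
theorem exists_mem_link (v : V) : ∃ a, a ∈ R.link v := by
  have := R.three_le v
  exact List.exists_mem_of_length_pos (by omega)

section Complex

variable [DecidableEq V]

variable (R) in
/-- The complex of a rotation system: the nonempty subsets of its triangles. -/
def complex : AbstractSimplicialComplex V where
  faces := {s | s.Nonempty ∧ ∃ v a b, R.Pos v a b ∧ s ⊆ {v, a, b}}
  isRelLowerSet_faces := by
    rintro s ⟨hs, v, a, b, h, hsub⟩
    exact ⟨hs, fun t hts ht => ⟨ht, v, a, b, h, hts.trans hsub⟩⟩
  singleton_mem v := by
    obtain ⟨a, ha⟩ := R.exists_mem_link v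
    obtain ⟨b, hb⟩ := exists_pos ha
    exact ⟨Finset.singleton_nonempty v, v, a, b, hb, by simp⟩

/-- The six orderings of a triangle fall into two classes under rotation, that of the positive
ordering and that of its mirror image. -/
theorem isTriangle_iff (u v w : V) :
    R.complex.IsTriangle u v w ↔ R.Pos u v w ∨ R.Pos v u w := by
  constructor
  · rintro ⟨huv, hvw, huw, -, a, b, c, h, hsub⟩
    have h1 := h.rot
    have h2 := h1.rot
    have hu : u ∈ ({a, b, c} : Finset V) := hsub (by simp)
    have hv : v ∈ ({a, b, c} : Finset V) := hsub (by simp)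
    have hw : w ∈ ({a, b, c} : Finset V) := hsub (by simp)
    simp only [Finset.mem_insert, Finset.mem_singleton] at hu hv hw
    rcases hu with rfl | rfl | rfl <;> rcases hv with rfl | rfl | rfl <;>
      rcases hw with rfl | rfl | rfl <;> simp_all
  · rintro (h | h)
    · exact ⟨h.ne_left, h.ne_right, h.ne, ⟨u, by simp⟩, u, v, w, h, subset_rfl⟩
    · exact ⟨h.ne_left.symm, h.ne, h.ne_right, ⟨u, by simp⟩, v, u, w, h, by
        rw [Finset.insert_comm]⟩

theorem adj_iff (u v : V) : R.complex.edgeGraph.Adj u v ↔ v ∈ R.link u := by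
  constructor
  · rintro ⟨huv, -, a, b, c, h, hsub⟩
    have h1 := h.rot
    have h2 := h1.rot
    have hu : u ∈ ({a, b, c} : Finset V) := hsub (by simp)
    have hv : v ∈ ({a, b, c} : Finset V) := hsub (by simp)
    simp only [Finset.mem_insert, Finset.mem_singleton] at hu hv
    rcases hu with rfl | rfl | rfl <;> rcases hv with rfl | rfl | rfl <;>
      first
      | exact absurd rfl huv
      | exact h.mem_left
      | exact h.mem_right
      | exact h1.mem_left
      | exact h1.mem_right
      | exact h2.mem_left
      | exact h2.mem_right
  · intro h
    obtain ⟨b, hb⟩ := exists_pos h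
    exact ⟨hb.ne_left, ⟨u, by simp⟩, u, v, b, hb, by
      intro x; simp only [Finset.mem_insert, Finset.mem_singleton]; tauto⟩

theorem reachable_root (n : ℕ) : ∀ v : V, R.rank v ≤ n → R.complex.edgeGraph.Reachable v R.root := by
  induction n with
  | zero =>
    intro v hv
    by_cases h : v = R.root
    · rw [h]
    · obtain ⟨w, -, hw⟩ := R.exists_lower v h
      omega
  | succ n ih =>
    intro v hv
    by_cases h : v = R.root
    · rw [h]
    · obtain ⟨w, hw, hlt⟩ := R.exists_lower v h
      exact ((adj_iff v w).2 hw).reachable.trans (ih w (by omega))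

/-- Positions in the list at `v` identify the link of `v` with a cycle graph; one direction of
adjacency is a positive triangle, the other a rotation of a negative one. -/
theorem isClosedSurface [Fintype V] : R.complex.IsClosedSurface where
  card_le := by
    rintro s ⟨-, v, a, b, -, h⟩
    exact (Finset.card_le_card h).trans Finset.card_le_three
  connected := by
    have : Nonempty V := ⟨R.root⟩
    exact ⟨fun u v => (reachable_root _ u le_rfl).trans (reachable_root _ v le_rfl).symm⟩
  link_cycle := by
    intro v
    refine ⟨(R.link v).length, R.three_le v, ⟨RelIso.symm ⟨Equiv.ofBijective
      (fun i : Fin (R.link v).length => ⟨(R.link v)[i], ?_⟩) ⟨?_, ?_⟩, ?_⟩⟩⟩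
    · exact (adj_iff _ _).2 (List.getElem_mem _)
    · intro i j hij
      have : (R.link v)[i.1] = (R.link v)[j.1] := congrArg Subtype.val hij
      exact Fin.ext ((R.nodup v).getElem_inj_iff.1 this)
    · rintro ⟨w, hw⟩
      obtain ⟨i, hi, h⟩ := List.mem_iff_getElem.1 ((adj_iff _ _).1 hw)
      exact ⟨⟨i, hi⟩, Subtype.ext h⟩
    · intro i j
      have hpos : ∀ i j : Fin (R.link v).length,
          R.Pos v (R.link v)[i] (R.link v)[j] ↔ (i + 1) % (R.link v).length = j.1 := by
        intro i j
        simp only [Pos, mem_cycPairs, Fin.getElem_fin]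
        constructor
        · rintro ⟨k, hk, h1, h2⟩
          rw [(R.nodup v).getElem_inj_iff] at h1 h2
          rw [← h1, h2]
        · intro h
          exact ⟨i, i.2, rfl, by simp only [h]⟩
      refine (isTriangle_iff _ _ _).trans ?_
      rw [cycleGraph_adj_iff_mod (R.three_le v)]
      refine or_congr (hpos i j) ?_
      rw [← hpos j i]
      exact ⟨fun h => h.rot, fun h => h.rot.rot⟩

open scoped Classical in
variable (R) in
/-- The oriented surface of a rotation system. -/
noncomputable def surface [Fintype V] : OrientedTriangulatedSurface V where
  complex := R.complex
  isClosedSurface := isClosedSurface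
  sign u v w := if R.Pos u v w then 1 else if R.Pos v u w then -1 else 0
  sign_of_isTriangle u v w h := by
    rw [isTriangle_iff] at h
    split_ifs <;> simp_all
  sign_of_not_isTriangle u v w h := by
    rw [isTriangle_iff] at h
    split_ifs <;> simp_all
  sign_swap_left u v w := by
    by_cases h : R.Pos u v w
    · simp [h, h.not_swap_left]
    · by_cases h' : R.Pos v u w <;> simp [h, h']
  sign_swap_right u v w := by
    have e : ∀ x y z, R.Pos x y z ↔ R.Pos y z x :=
      fun x y z => ⟨fun h => h.rot, fun h => h.rot.rot⟩
    have e1 : R.Pos u w v ↔ R.Pos v u w := (e v u w).symm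
    have e2 : R.Pos w u v ↔ R.Pos u v w := e w u v
    rw [e1, e2]
    by_cases h : R.Pos u v w
    · simp [h, h.not_swap_left]
    · by_cases h' : R.Pos v u w <;> simp [h, h']
  coherent u v w w' hne h h' := by
    rw [isTriangle_iff] at h h'
    rcases h with h | h <;> rcases h' with h' | h'
    · exact absurd (h.unique h') hne
    · have h1 : ¬ R.Pos u v w' := h'.not_swap_left
      simp [h, h', h1]
    · have h1 : ¬ R.Pos u v w := h.not_swap_left
      simp [h, h', h1]
    · exact absurd (h.unique h') hne

end Complex

end RotationSystem

/-! ### Oriented triangulated surfaces: positive triangles -/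

namespace OrientedTriangulatedSurface

variable {V : Type*} [Fintype V] [DecidableEq V] (K : OrientedTriangulatedSurface V)

/-- `[u v w]` is a positive triangle. -/
def Pos (u v w : V) : Prop := K.sign u v w = 1

instance (u v w : V) : Decidable (K.Pos u v w) := inferInstanceAs (Decidable (_ = _))

/-- `u` and `v` span an edge. -/
abbrev Adj (u v : V) : Prop := K.complex.edgeGraph.Adj u v

variable {K} {u v w x : V}

theorem sign_rot (u v w : V) : K.sign v w u = K.sign u v w := by
  rw [K.sign_swap_right, K.sign_swap_left, neg_neg]

theorem Pos.rot (h : K.Pos u v w) : K.Pos v w u := (sign_rot u v w).trans h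

theorem Pos.isTriangle (h : K.Pos u v w) : K.complex.IsTriangle u v w := by
  by_contra h'
  have := K.sign_of_not_isTriangle u v w h'
  rw [Pos] at h
  omega

theorem isTriangle_iff : K.complex.IsTriangle u v w ↔ K.Pos u v w ∨ K.Pos v u w := by
  constructor
  · intro h
    rcases K.sign_of_isTriangle u v w h with h' | h'
    · exact Or.inl h'
    · exact Or.inr (by rw [Pos, K.sign_swap_left, h', neg_neg])
  · rintro (h | h)
    · exact h.isTriangle
    · obtain ⟨h1, h2, h3, h4⟩ := h.isTriangle
      exact ⟨h1.symm, h3, h2, by rwa [Finset.insert_comm]⟩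

theorem Pos.adj (h : K.Pos u v w) : K.Adj u v := by
  obtain ⟨h1, h2, h3, h4⟩ := h.isTriangle
  refine ⟨h1, (K.complex.isRelLowerSet_faces h4).2 ?_ ⟨u, by simp⟩⟩
  intro x
  simp only [Finset.mem_insert, Finset.mem_singleton]
  tauto

theorem Pos.adj' (h : K.Pos u v w) : K.Adj u w := h.rot.rot.adj.symm

theorem Pos.unique (h : K.Pos u v w) (h' : K.Pos u v x) : w = x := by
  by_contra hne
  have := K.coherent u v w x hne h.isTriangle h'.isTriangle
  rw [Pos] at h h'
  omega

theorem Pos.unique_left (h : K.Pos u v x) (h' : K.Pos u w x) : v = w :=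
  h.rot.rot.unique h'.rot.rot

theorem Pos.not_swap (h : K.Pos u v w) : ¬ K.Pos v u w := by
  intro h'
  rw [Pos, K.sign_swap_left] at h'
  rw [Pos] at h
  omega

/-- In the link cycle of `u` the vertex `v` has two distinct neighbours, so the edge `uv` lies in
two triangles. By coherence these have opposite signs, hence one is positive. -/
theorem exists_pos (h : K.Adj u v) : ∃ w, K.Pos u v w := by
  obtain ⟨n, hn, ⟨e⟩⟩ := K.isClosedSurface.link_cycle u
  obtain ⟨m, rfl⟩ : ∃ m, n = m + 3 := ⟨n - 3, by omega⟩
  set i := e ⟨v, h⟩ with hi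
  have key : ∀ j, (SimpleGraph.cycleGraph (m + 3)).Adj i j →
      K.complex.IsTriangle u v (e.symm j).1 := by
    intro j hj
    have := e.symm.map_adj_iff.2 hj
    rw [hi, e.symm_apply_apply] at this
    exact this
  have h1 := key (i + 1) (by simp [SimpleGraph.cycleGraph_adj])
  have h2 := key (i - 1) (by simp [SimpleGraph.cycleGraph_adj])
  have hne : (e.symm (i + 1)).1 ≠ (e.symm (i - 1)).1 := by
    intro h
    have h' := e.symm.injective (Subtype.ext h)
    -- The two neighbours coincide only if `2 = 0` modulo the length of the cycle, which is at least
    -- three.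
    have h'' : (1 : Fin (m + 3)) + 1 = 0 := by
      have := congrArg (fun t => t - i + 1) h'
      simpa using this
    have := congrArg Fin.val h''
    rw [Fin.val_add, Fin.val_one, Fin.val_zero, Nat.mod_eq_of_lt (by omega)] at this
    omega
  rcases K.sign_of_isTriangle u v _ h1 with h3 | h3
  · exact ⟨_, h3⟩
  · refine ⟨_, (K.coherent u v _ _ hne h1 h2).trans ?_⟩
    rw [h3, neg_neg]

/-- The link of a vertex is a single cycle: a set of neighbours that contains the successors of its
elements contains all neighbours. -/
theorem link_induction {S : Set V} (hS : ∀ y ∈ S, K.Adj u y) (hx : x ∈ S)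
    (hsucc : ∀ y ∈ S, ∀ z, K.Pos u y z → z ∈ S) {y : V} (hy : K.Adj u y) : y ∈ S := by
  classical
  -- The successor map is an injective self-map of the finite set `S`, hence surjective, so `S` is
  -- closed under predecessors too. Walks in the connected link then cannot leave it.
  have hpred : ∀ y ∈ S, ∀ z, K.Pos u z y → z ∈ S := by
    choose g hg using fun a : S => exists_pos (hS a a.2)
    let g' : S → S := fun a => ⟨g a, hsucc a a.2 _ (hg a)⟩
    have hinj : Function.Injective g' := by
      intro a b hab
      have hab' : g a = g b := congrArg Subtype.val hab
      have h1 := hg a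
      rw [hab'] at h1
      exact Subtype.ext (h1.unique_left (hg b))
    have hsurj : Function.Surjective g' := Finite.injective_iff_surjective.1 hinj
    intro y hy z hz
    obtain ⟨a, ha⟩ := hsurj ⟨y, hy⟩
    have ha' : g a = y := congrArg Subtype.val ha
    have h1 := hg a
    rw [ha'] at h1
    rw [hz.unique_left h1]
    exact a.2
  obtain ⟨n, hn, ⟨e⟩⟩ := K.isClosedSurface.link_cycle u
  obtain ⟨m, rfl⟩ : ∃ m, n = m + 1 := ⟨n - 1, by omega⟩
  have hconn : (K.complex.linkGraph u).Preconnected :=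
    (e.connected_iff.2 (SimpleGraph.cycleGraph_connected (n := m))).preconnected
  have hwalk : ∀ a b, (K.complex.linkGraph u).Walk a b → a.1 ∈ S → b.1 ∈ S := by
    intro a b p
    induction p with
    | nil => exact id
    | cons hadj _ ih =>
      intro ha
      refine ih ?_
      rcases isTriangle_iff.1 hadj with h | h
      · exact hsucc _ ha _ h
      · exact hpred _ ha _ h.rot
  obtain ⟨p⟩ := hconn ⟨x, hS x hx⟩ ⟨y, hy⟩
  exact hwalk _ _ p hx

/-! ### Face counts and the Euler characteristic -/

variable (K)

/-- The positively ordered triangles. -/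
def posTriples : Finset (V × V × V) := {t | K.Pos t.1 t.2.1 t.2.2}

noncomputable instance : DecidableRel K.Adj := Classical.decRel _

/-- The ordered pairs of adjacent vertices. -/
noncomputable def arcs : Finset (V × V) := {p | K.Adj p.1 p.2}

/-- Every directed edge starts exactly one positive triangle. -/
theorem card_posTriples_eq_card_arcs : K.posTriples.card = K.arcs.card := by
  refine Finset.card_bij (fun t _ => (t.1, t.2.1)) ?_ ?_ ?_
  · intro t ht
    simp only [posTriples, Finset.mem_filter, Finset.mem_univ, true_and] at ht
    simpa [arcs] using ht.adj
  · rintro ⟨a, b, c⟩ ht ⟨a', b', c'⟩ ht' h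
    simp only [posTriples, Finset.mem_filter, Finset.mem_univ, true_and, Prod.mk.injEq] at ht ht' h
    obtain ⟨rfl, rfl⟩ := h
    rw [ht.unique ht']
  · rintro ⟨a, b⟩ h
    simp only [arcs, Finset.mem_filter, Finset.mem_univ, true_and] at h
    obtain ⟨c, hc⟩ := exists_pos h
    exact ⟨(a, b, c), by simpa [posTriples] using hc, rfl⟩

theorem card_posTriples_eq_sum :
    K.posTriples.card = ∑ v, (Finset.univ.filter fun w => K.Adj v w).card := by
  rw [card_posTriples_eq_card_arcs, arcs, Finset.card_filter, Fintype.sum_prod_type]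
  simp only [Finset.card_filter]

theorem ncard_vertices : {s ∈ K.complex.faces | s.card = 1}.ncard = Fintype.card V := by
  have : {s ∈ K.complex.faces | s.card = 1} = Set.range fun v : V => ({v} : Finset V) := by
    ext s
    simp only [Set.mem_ofPred_eq, Set.mem_range, Finset.card_eq_one]
    constructor
    · rintro ⟨-, v, rfl⟩
      exact ⟨v, rfl⟩
    · rintro ⟨v, rfl⟩
      exact ⟨K.complex.singleton_mem v, v, rfl⟩
  rw [this, ← Set.image_univ, Set.ncard_image_of_injective _ Finset.singleton_injective,
    Set.ncard_univ, Nat.card_eq_fintype_card]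

theorem ncard_edges : 2 * {s ∈ K.complex.faces | s.card = 2}.ncard = K.arcs.card := by
  classical
  rw [Set.ncard_eq_toFinset_card' {s ∈ K.complex.faces | s.card = 2}]
  have hmaps : ∀ p ∈ K.arcs, ({p.1, p.2} : Finset V) ∈
      {s ∈ K.complex.faces | s.card = 2}.toFinset := by
    intro p hp
    simp only [arcs, Finset.mem_filter, Finset.mem_univ, true_and] at hp
    simp only [Set.mem_toFinset, Set.mem_ofPred_eq]
    exact ⟨hp.2, Finset.card_pair hp.1⟩
  rw [Finset.card_eq_sum_card_fiberwise hmaps, Finset.sum_const_nat (m := 2), mul_comm]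
  intro s hs
  simp only [Set.mem_toFinset, Set.mem_ofPred_eq] at hs
  obtain ⟨hs, hc⟩ := hs
  obtain ⟨a, b, hab, rfl⟩ := Finset.card_eq_two.1 hc
  have hadj : K.Adj a b := ⟨hab, hs⟩
  rw [show (K.arcs.filter fun p => ({p.1, p.2} : Finset V) = {a, b}) = {(a, b), (b, a)} from ?_]
  · exact Finset.card_pair (by simp [hab])
  · ext ⟨x, y⟩
    simp only [arcs, Finset.mem_filter, Finset.mem_univ, true_and, Finset.mem_insert,
      Finset.mem_singleton, Prod.mk.injEq]
    constructor
    · rintro ⟨hxy, h⟩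
      have hx : x ∈ ({a, b} : Finset V) := h ▸ (by simp)
      have hy : y ∈ ({a, b} : Finset V) := h ▸ (by simp)
      have hne := hxy.1
      simp only [Finset.mem_insert, Finset.mem_singleton] at hx hy
      rcases hx with rfl | rfl <;> rcases hy with rfl | rfl <;> simp_all
    · rintro (⟨rfl, rfl⟩ | ⟨rfl, rfl⟩)
      · exact ⟨hadj, rfl⟩
      · exact ⟨hadj.symm, Finset.pair_comm _ _⟩

theorem ncard_triangles : 3 * {s ∈ K.complex.faces | s.card = 3}.ncard = K.posTriples.card := by
  classical
  rw [Set.ncard_eq_toFinset_card' {s ∈ K.complex.faces | s.card = 3}]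
  have hmaps : ∀ t ∈ K.posTriples, ({t.1, t.2.1, t.2.2} : Finset V) ∈
      {s ∈ K.complex.faces | s.card = 3}.toFinset := by
    intro t ht
    simp only [posTriples, Finset.mem_filter, Finset.mem_univ, true_and] at ht
    obtain ⟨h1, h2, h3, h4⟩ := ht.isTriangle
    simp only [Set.mem_toFinset, Set.mem_ofPred_eq]
    exact ⟨h4, Finset.card_eq_three.2 ⟨_, _, _, h1, h3, h2, rfl⟩⟩
  rw [Finset.card_eq_sum_card_fiberwise hmaps, Finset.sum_const_nat (m := 3), mul_comm]
  intro s hs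
  simp only [Set.mem_toFinset, Set.mem_ofPred_eq] at hs
  obtain ⟨hs, hc⟩ := hs
  have hpos : ∃ a b c, K.Pos a b c ∧ s = {a, b, c} := by
    obtain ⟨a, b, c, hab, hac, hbc, rfl⟩ := Finset.card_eq_three.1 hc
    rcases isTriangle_iff.1 (⟨hab, hbc, hac, hs⟩ : K.complex.IsTriangle a b c) with h | h
    · exact ⟨a, b, c, h, rfl⟩
    · exact ⟨b, a, c, h, Finset.insert_comm _ _ _⟩
  obtain ⟨a, b, c, h, rfl⟩ := hpos
  obtain ⟨hab, hbc, hac, -⟩ := h.isTriangle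
  rw [show (K.posTriples.filter fun t => ({t.1, t.2.1, t.2.2} : Finset V) = {a, b, c}) =
    {(a, b, c), (b, c, a), (c, a, b)} from ?_]
  · exact Finset.card_eq_three.2 ⟨_, _, _, by simp [hab], by simp [hac], by simp [hbc], rfl⟩
  · ext ⟨x, y, z⟩
    simp only [posTriples, Finset.mem_filter, Finset.mem_univ, true_and, Finset.mem_insert,
      Finset.mem_singleton, Prod.mk.injEq]
    constructor
    · rintro ⟨hxyz, h'⟩
      have hx : x ∈ ({a, b, c} : Finset V) := h' ▸ (by simp)
      have hy : y ∈ ({a, b, c} : Finset V) := h' ▸ (by simp)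
      obtain ⟨hxy, hyz, hxz, -⟩ := hxyz.isTriangle
      have u1 := h.unique (x := z)
      have u2 := h.rot.unique (x := z)
      have u3 := h.rot.rot.unique (x := z)
      -- An ordering with two vertices exchanged would make the same triangle negative; `n1`, `n2`,
      -- `n3` exclude the three such orderings.
      have n1 : x = b → y = a → False := by
        rintro rfl rfl
        have hz : z ∈ ({y, x, c} : Finset V) := h' ▸ (by simp)
        simp only [Finset.mem_insert, Finset.mem_singleton] at hz
        rcases hz with rfl | rfl | rfl
        · exact hyz rfl
        · exact hxz rfl
        · exact h.not_swap hxyz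
      have n2 : x = c → y = b → False := by
        rintro rfl rfl
        have hz : z ∈ ({a, y, x} : Finset V) := h' ▸ (by simp)
        simp only [Finset.mem_insert, Finset.mem_singleton] at hz
        rcases hz with rfl | rfl | rfl
        · exact h.rot.not_swap hxyz
        · exact hyz rfl
        · exact hxz rfl
      have n3 : x = a → y = c → False := by
        rintro rfl rfl
        have hz : z ∈ ({x, b, y} : Finset V) := h' ▸ (by simp)
        simp only [Finset.mem_insert, Finset.mem_singleton] at hz
        rcases hz with rfl | rfl | rfl
        · exact hxz rfl
        · exact h.rot.rot.not_swap hxyz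
        · exact hyz rfl
      simp only [Finset.mem_insert, Finset.mem_singleton] at hx hy
      rcases hx with rfl | rfl | rfl <;> rcases hy with rfl | rfl | rfl <;> simp_all
    · rintro (⟨rfl, rfl, rfl⟩ | ⟨rfl, rfl, rfl⟩ | ⟨rfl, rfl, rfl⟩)
      · exact ⟨h, rfl⟩
      · exact ⟨h.rot, by ext; simp; tauto⟩
      · exact ⟨h.rot.rot, by ext; simp; tauto⟩

/-- With `T` positively ordered triples, `2E = T` and `3F = T`, so `6(V - E + F) = 6V - 3T + 2T`. -/
theorem eulerChar₂_eq : 6 * K.complex.eulerChar₂ = 6 * Fintype.card V - K.posTriples.card := by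
  have h1 := K.ncard_vertices
  have h2 := K.ncard_edges
  have h3 := K.ncard_triangles
  rw [← card_posTriples_eq_card_arcs] at h2
  rw [AbstractSimplicialComplex.eulerChar₂]
  omega

theorem hasGenus_iff (g : ℕ) :
    K.HasGenus g ↔ (K.posTriples.card : ℤ) + 12 = 6 * Fintype.card V + 12 * g := by
  have := K.eulerChar₂_eq
  rw [HasGenus]
  omega

theorem card_arcs_le : K.arcs.card + Fintype.card V ≤ Fintype.card V * Fintype.card V := by
  classical
  have h : K.arcs ⊆ (Finset.univ : Finset V).offDiag := by
    intro p hp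
    simp only [arcs, Finset.mem_filter, Finset.mem_univ, true_and] at hp
    simpa using hp.1
  have := Finset.card_le_card h
  have h' : Fintype.card V ≤ Fintype.card V * Fintype.card V := Nat.le_mul_self _
  rw [Finset.offDiag_card, Finset.card_univ] at this
  omega

theorem card_neighbors_lt (v : V) :
    (Finset.univ.filter fun w => K.Adj v w).card < Fintype.card V := by
  rw [← Finset.card_univ]
  refine Finset.card_lt_card (Finset.filter_ssubset.2 ⟨v, Finset.mem_univ v, ?_⟩)
  exact fun h => h.1 rfl

theorem nonempty_of_surface (K : OrientedTriangulatedSurface V) : Nonempty V :=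
  K.isClosedSurface.connected.nonempty

/-- The degrees sum to `6n`, and to at most `n(n - 1)`. -/
theorem seven_le_card_of_hasGenus_one (h : K.HasGenus 1) : 7 ≤ Fintype.card V := by
  have h1 := (K.hasGenus_iff 1).1 h
  have h2 := K.card_arcs_le
  have h3 : 0 < Fintype.card V := Fintype.card_pos_iff.2 K.nonempty_of_surface
  rw [← card_posTriples_eq_card_arcs] at h2
  by_contra hlt
  have : K.posTriples.card = 6 * Fintype.card V := by omega
  rw [this] at h2
  nlinarith

/-- The degrees sum to `6n + 12`, and to at most `n(n - 1)`. This leaves `n = 9` open, where `66 ≤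
72`. -/
theorem nine_le_card_of_hasGenus_two (h : K.HasGenus 2) : 9 ≤ Fintype.card V := by
  have h1 := (K.hasGenus_iff 2).1 h
  have h2 := K.card_arcs_le
  rw [← card_posTriples_eq_card_arcs] at h2
  by_contra hlt
  have : K.posTriples.card = 6 * Fintype.card V + 12 := by omega
  rw [this] at h2
  nlinarith

/-! ### Counting triangles over a vertex -/

/-- The number of positive triangles at `v`. -/
theorem card_pos_eq_card_neighbors (v : V) :
    (Finset.univ.filter fun p : V × V => K.Pos v p.1 p.2).card =
      (Finset.univ.filter fun w => K.Adj v w).card := by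
  refine Finset.card_bij (fun p _ => p.1) ?_ ?_ ?_
  · intro p hp
    simp only [Finset.mem_filter, Finset.mem_univ, true_and] at hp ⊢
    exact hp.adj
  · rintro ⟨b, c⟩ ht ⟨b', c'⟩ ht' h
    simp only [Finset.mem_filter, Finset.mem_univ, true_and] at ht ht' h
    subst h
    rw [ht.unique ht']
  · intro b h
    simp only [Finset.mem_filter, Finset.mem_univ, true_and] at h
    obtain ⟨c, hc⟩ := exists_pos h
    exact ⟨(b, c), by simpa using hc, rfl⟩

theorem abs_sign_eq (u v w : V) : |K.sign u v w| =
    (if K.Pos u v w then 1 else 0) + if K.Pos u w v then 1 else 0 := by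
  have hs := K.sign_swap_right u v w
  simp only [Pos, hs]
  by_cases h : K.complex.IsTriangle u v w
  · rcases K.sign_of_isTriangle u v w h with h | h <;> simp [h]
  · simp [K.sign_of_not_isTriangle u v w h]

theorem sum_abs_sign_eq (v : V) : ∑ a, ∑ b, |K.sign v a b| =
    2 * ((Finset.univ.filter fun w => K.Adj v w).card : ℤ) := by
  have h : ∑ a, ∑ b, (if K.Pos v a b then (1 : ℤ) else 0) =
      ((Finset.univ.filter fun w => K.Adj v w).card : ℤ) := by
    rw [← card_pos_eq_card_neighbors, Finset.card_filter, Fintype.sum_prod_type]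
    push_cast
    rfl
  simp only [abs_sign_eq, Finset.sum_add_distrib]
  rw [Finset.sum_comm (f := fun a b => if K.Pos v b a then (1 : ℤ) else 0), h]
  ring

end OrientedTriangulatedSurface

/-! ### Lower bounds from the degree -/

theorem abs_chainMap₂_le {V W : Type*} [Fintype V] [DecidableEq W] (f : V → W)
    (c : V → V → V → ℤ) (x y z : W) :
    |chainMap₂ f c x y z| ≤
      ∑ u, ∑ v, ∑ w, if f u = x ∧ f v = y ∧ f w = z then |c u v w| else 0 := by
  refine (Finset.abs_sum_le_sum_abs _ _).trans (Finset.sum_le_sum fun u _ => ?_)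
  refine (Finset.abs_sum_le_sum_abs _ _).trans (Finset.sum_le_sum fun v _ => ?_)
  refine (Finset.abs_sum_le_sum_abs _ _).trans (Finset.sum_le_sum fun w _ => ?_)
  split_ifs <;> simp

namespace OrientedTriangulatedSurface

variable {V : Type*} [Fintype V] [DecidableEq V] (K : OrientedTriangulatedSurface V)

/-- Over every vertex of the 7-vertex torus, the degrees sum up to at least six times the degree of
the map. -/
theorem six_mul_natAbs_le {f : V → Fin 7} {d : ℤ} (hf : HasDegree K torus₇ f d) (x : Fin 7) :
    6 * d.natAbs ≤
      ∑ v ∈ Finset.univ.filter (f · = x), (Finset.univ.filter fun w => K.Adj v w).card := by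
  -- Six triangles at `x`, each counted in two orders. The same double count makes the sum over the
  -- triangles at `v` in `sum_abs_sign_eq` twice the degree of `v`.
  have h12 : ∑ y, ∑ z, |torus₇.sign x y z| = 12 := by
    revert x
    decide +kernel
  have h1 : ∑ y, ∑ z, |chainMap₂ f K.sign x y z| = 12 * |d| := by
    rw [HasDegree] at hf
    rw [hf]
    simp only [Pi.smul_apply, smul_eq_mul, abs_mul, ← Finset.mul_sum]
    rw [h12, mul_comm]
  have h2 : ∑ y, ∑ z, |chainMap₂ f K.sign x y z| ≤
      ∑ u, if f u = x then ∑ v, ∑ w, |K.sign u v w| else 0 := by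
    calc _ ≤ ∑ y, ∑ z, ∑ u, ∑ v, ∑ w,
          if f u = x ∧ f v = y ∧ f w = z then |K.sign u v w| else 0 :=
          Finset.sum_le_sum fun y _ => Finset.sum_le_sum fun z _ => abs_chainMap₂_le _ _ _ _ _
      _ = ∑ u, ∑ v, ∑ w, ∑ y, ∑ z,
          if f u = x ∧ f v = y ∧ f w = z then |K.sign u v w| else 0 := by
          simp_rw [Finset.sum_comm (s := (Finset.univ : Finset (Fin 7)))
            (t := (Finset.univ : Finset V))]
      _ = _ := by
          refine Finset.sum_congr rfl fun u _ => ?_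
          by_cases hu : f u = x
          · simp [hu, ite_and]
          · simp [hu]
  rw [h1, ← Finset.sum_filter] at h2
  simp only [sum_abs_sign_eq, ← Finset.mul_sum] at h2
  have h3 : |d| = d.natAbs := Int.abs_eq_natAbs d
  rw [h3] at h2
  have : (6 * d.natAbs : ℤ) ≤
      ∑ v ∈ Finset.univ.filter (f · = x), ((Finset.univ.filter fun w => K.Adj v w).card : ℤ) := by
    linarith
  exact_mod_cast this

theorem natAbs_le_card_posTriples {f : V → Fin 7} {d : ℤ} (hf : HasDegree K torus₇ f d) :
    42 * d.natAbs ≤ K.posTriples.card := by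
  rw [card_posTriples_eq_sum, ← Finset.sum_fiberwise (s := Finset.univ) (g := f)]
  calc 42 * d.natAbs = ∑ _x : Fin 7, 6 * d.natAbs := by simp; ring
    _ ≤ _ := Finset.sum_le_sum fun x _ => six_mul_natAbs_le K hf x

theorem seven_mul_natAbs_le_of_hasGenus_one {f : V → Fin 7} {d : ℤ} (h : K.HasGenus 1)
    (hf : HasDegree K torus₇ f d) : 7 * d.natAbs ≤ Fintype.card V := by
  have h1 := (K.hasGenus_iff 1).1 h
  have h2 := K.natAbs_le_card_posTriples hf
  omega

theorem seven_mul_natAbs_le_of_hasGenus_two {f : V → Fin 7} {d : ℤ} (h : K.HasGenus 2)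
    (hf : HasDegree K torus₇ f d) : 7 * d.natAbs ≤ Fintype.card V + 2 := by
  have h1 := (K.hasGenus_iff 2).1 h
  have h2 := K.natAbs_le_card_posTriples hf
  omega

/-- A map of degree `± 2` has a fibre with one point only over a vertex of degree `12`. -/
theorem thirteen_le_card {f : V → Fin 7} {d : ℤ} (hd : d.natAbs = 2)
    (hf : HasDegree K torus₇ f d) : 13 ≤ Fintype.card V := by
  by_contra hlt
  -- With at most twelve vertices every degree is at most eleven, less than the twelve required over
  -- `x`. Two points in each fibre would then give fourteen vertices.
  have hfib : ∀ x, 2 ≤ (Finset.univ.filter (f · = x)).card := by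
    intro x
    have h1 := six_mul_natAbs_le K hf x
    have h2 := Finset.sum_le_card_nsmul (Finset.univ.filter (f · = x))
      (fun v => (Finset.univ.filter fun w => K.Adj v w).card) 11
      fun v _ => by have := K.card_neighbors_lt v; omega
    rw [smul_eq_mul] at h2
    omega
  have h1 : Fintype.card V = ∑ x : Fin 7, (Finset.univ.filter (f · = x)).card := by
    rw [← Finset.card_univ]
    exact Finset.card_eq_sum_card_fiberwise fun _ _ => Finset.mem_univ _
  have h2 : ∑ _x : Fin 7, 2 ≤ ∑ x : Fin 7, (Finset.univ.filter (f · = x)).card :=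
    Finset.sum_le_sum fun x _ => hfib x
  simp at h2
  omega

end OrientedTriangulatedSurface

/-! ### A surface of genus two has at least ten vertices

A triangulated oriented surface of genus two with nine vertices would have a vertex adjacent to all
others. Its star is fixed, and a search through the possible third vertices of the remaining
directed edges, which closes the links one after the other, shows that there is none. -/

namespace NineVertexSearch

/-- The entry at `(u, v)` in a table of base-16 digits. -/
def entry (T u v : ℕ) : ℕ := Nat.mod (Nat.shiftRight T (Nat.mul 4 (Nat.add (Nat.mul 9 u) v))) 16

/-- The table with `c` written at the empty entry `(u, v)`. -/
def setEntry (T u v c : ℕ) : ℕ :=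
  Nat.add T (Nat.shiftLeft c (Nat.mul 4 (Nat.add (Nat.mul 9 u) v)))

/-- The partial link cycle at `u`, followed from `x` until it reaches `v`. -/
def walk (T u v : ℕ) : ℕ → ℕ → List ℕ → Option (List ℕ)
  | 0, _, _ => none
  | n + 1, x, L =>
    match Nat.beq x v with
    | true => some (x :: L)
    | false =>
      match entry T u x with
      | 0 => none
      | y + 1 => walk T u v n y (x :: L)

/-- A search state: the table of third vertices (shifted by one, zero if unknown), the mask of the
vertices with a completed link, and the number of non-neighbours of these vertices. -/
structure State where
  table : ℕ
  mask : ℕ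
  deficit : ℕ

/-- Whether every known arc at `u` starts in `L`. -/
def rowSubset (T u : ℕ) (L : List ℕ) : Bool :=
  (List.range 9).all fun x => Nat.beq (entry T u x) 0 || L.any (Nat.beq x)

/-- Add the arc from `v` to `w` to the link of `u`; `none` if this is impossible. -/
def addArc (s : State) (u v w : ℕ) : Option State :=
  match entry s.table u v with
  | x + 1 => if Nat.beq x w then some s else none
  | 0 =>
    match Nat.land (Nat.shiftRight s.mask u) 1 with
    | _ + 1 => none
    | 0 =>
      -- If the known arcs lead from `w` back to `v`, the new arc closes a cycle, which must be the
      -- whole link of `u`: no known arc at `u` may lie outside it, and its missing neighbours are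
      -- charged to the deficit. The deficit is at most six since the degrees sum to `66 = 9 * 8 -
      -- 6`.
      match walk s.table u v 9 w [] with
      | none => some ⟨setEntry s.table u v (w + 1), s.mask, s.deficit⟩
      | some L =>
        match rowSubset s.table u L && Nat.ble (s.deficit + (8 - L.length)) 6 with
        | false => none
        | true => some ⟨setEntry s.table u v (w + 1), s.mask ||| 2 ^ u,
            s.deficit + (8 - L.length)⟩

/-- Add a positive triangle; `none` if this is impossible. -/
def addTriangle (s : State) (u v w : ℕ) : Option State :=
  ((addArc s u v w).bind fun s => addArc s v w u).bind fun s => addArc s w u v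

/-- Whether the state has no completion, decided by following the links of `u, u + 1, …`. -/
def refute : ℕ → State → ℕ → ℕ → Bool
  | 0, _, _, _ => false
  | n + 1, s, u, v =>
    match Nat.land (Nat.shiftRight s.mask u) 1 with
    -- The next vertex is `u + 3`, taken cyclically in `1, …, 8`; as three is prime to eight, all
    -- eight are visited. The walk restarts at `0`, which is a neighbour of each of them.
    | _ + 1 => refute n s (Nat.succ (Nat.mod (Nat.add u 2) 8)) 0
    | 0 =>
      match entry s.table u v with
      | w + 1 => refute n s u w
      | 0 => (List.range 9).all fun w => Nat.beq u w || Nat.beq v w ||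
          match addTriangle s u v w with
          | none => true
          | some s' => refute n s' u w

/-- The star of the vertex `0`. -/
def star : State :=
  ⟨(List.range 8).foldl (fun T i =>
    setEntry (setEntry (setEntry T 0 (i + 1) ((i + 1) % 8 + 2)) (i + 1) ((i + 1) % 8 + 1) 1)
      ((i + 1) % 8 + 1) 0 (i + 2)) 0, 1, 0⟩

-- The number `100` is fuel. Running out of it yields `false`, so the value `true` certifies that
-- every branch ended in a contradiction.
set_option maxRecDepth 100000 in
theorem refute_star : refute 100 star 1 0 = true := by decide +kernel

end NineVertexSearch

/-! ### Soundness of the search -/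

namespace NineVertexSearch

theorem entry_eq (T u v : ℕ) : entry T u v = T / 16 ^ (9 * u + v) % 16 := by
  change (T >>> (4 * (9 * u + v))) % 16 = _
  rw [Nat.shiftRight_eq_div_pow, pow_mul]
  norm_num

theorem setEntry_eq (T u v c : ℕ) : setEntry T u v c = T + c * 16 ^ (9 * u + v) := by
  change T + c <<< (4 * (9 * u + v)) = _
  rw [Nat.shiftLeft_eq, pow_mul]
  norm_num

/-- Adding to a zero digit causes no carry, so the other digits are unaffected. -/
theorem div_pow_add_mul_pow {T c p : ℕ} (h : T / 16 ^ p % 16 = 0) (hc : c < 16) (q : ℕ) :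
    (T + c * 16 ^ p) / 16 ^ q % 16 = if q = p then c else T / 16 ^ q % 16 := by
  have hpos : ∀ n, 0 < 16 ^ n := fun n => by positivity
  rcases lt_trichotomy q p with hlt | rfl | hlt
  · obtain ⟨k, rfl⟩ := Nat.exists_eq_add_of_lt hlt
    rw [if_neg (by omega), show c * 16 ^ (q + k + 1) = c * 16 ^ k * 16 * 16 ^ q by ring,
      Nat.add_mul_div_right _ _ (hpos q), Nat.add_mul_mod_self_right]
  · rw [if_pos rfl, Nat.add_mul_div_right _ _ (hpos q), Nat.add_mod, h, Nat.zero_add, Nat.mod_mod,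
      Nat.mod_eq_of_lt hc]
  · obtain ⟨k, rfl⟩ := Nat.exists_eq_add_of_lt hlt
    rw [if_neg (by omega), show p + k + 1 = p + (1 + k) by ring, pow_add, ← Nat.div_div_eq_div_mul,
      Nat.add_mul_div_right _ _ (hpos p), pow_add, pow_one, ← Nat.div_div_eq_div_mul,
      ← Nat.div_div_eq_div_mul, ← Nat.div_div_eq_div_mul]
    congr 2
    omega

theorem entry_setEntry {T u v c : ℕ} (h : entry T u v = 0) (hc : c < 16) (hv : v < 9)
    {u' v' : ℕ} (hv' : v' < 9) :
    entry (setEntry T u v c) u' v' = if u' = u ∧ v' = v then c else entry T u' v' := by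
  rw [entry_eq] at h
  simp only [entry_eq, setEntry_eq]
  rw [div_pow_add_mul_pow h hc]
  congr 1
  apply propext
  omega

/-- The positive triangles of a surface with vertices `0, …, 8`, together with bounds `δ` for the
numbers of non-neighbours. -/
structure Model (P : ℕ → ℕ → ℕ → Prop) (δ : ℕ → ℕ) : Prop where
  lt : ∀ {u v w}, P u v w → u < 9
  rot : ∀ {u v w}, P u v w → P v w u
  unique : ∀ {u v w w'}, P u v w → P u v w' → w = w'
  ne : ∀ {u v w}, P u v w → u ≠ v
  exists_opposite : ∀ {u v w}, P u v w → ∃ x, P v u x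
  link : ∀ {u} (S : List ℕ) {x y z}, x ∈ S → (∀ a ∈ S, ∃ b ∈ S, P u a b) → P u y z → y ∈ S
  le_deficit : ∀ {u}, u < 9 → ∀ S : List ℕ, (∀ x y, P u x y → x ∈ S) → 8 ≤ δ u + S.length
  sum_deficit : ∑ u ∈ Finset.range 9, δ u ≤ 6
  full : ∀ {u}, 0 < u → u < 9 → ∃ w, P u 0 w

variable {P : ℕ → ℕ → ℕ → Prop} {δ : ℕ → ℕ}

/-- The model `P` is a completion of the state `s`. -/
structure Completes (P : ℕ → ℕ → ℕ → Prop) (δ : ℕ → ℕ) (s : State) : Prop where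
  pos_of_entry : ∀ {u v w}, v < 9 → entry s.table u v = w + 1 → P u v w
  entry_of_mask : ∀ {u}, s.mask.testBit u → ∀ {v w}, P u v w → entry s.table u v = w + 1
  -- Completed vertices have been charged to `s.deficit`; the others still enter with `δ`.
  deficit : s.deficit + ∑ u ∈ (Finset.range 9).filter (fun u => ¬ s.mask.testBit u), δ u ≤ 6

theorem testBit_eq_true_of_land {m u k : ℕ} (h : Nat.land (Nat.shiftRight m u) 1 = k + 1) :
    m.testBit u = true := by
  have h' : (1 &&& (m >>> u)) = k + 1 := by rw [Nat.land_comm]; exact h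
  simp [Nat.testBit, h']

theorem testBit_eq_false_of_land {m u : ℕ} (h : Nat.land (Nat.shiftRight m u) 1 = 0) :
    m.testBit u = false := by
  have h' : (1 &&& (m >>> u)) = 0 := by rw [Nat.land_comm]; exact h
  simp [Nat.testBit, h']

/-- Apart from its end `v`, every vertex of the walk has its recorded successor in the walk. Adding
the arc from `v` to the start therefore makes the list closed under successors, hence the whole link
by `Model.link`. -/
theorem walk_spec {s : State} (hs : Completes P δ s) (hP : Model P δ) {u v : ℕ} (n : ℕ) :
    ∀ (x : ℕ) (L : List ℕ) {L' : List ℕ}, x < 9 → walk s.table u v n x L = some L' →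
      x ∈ L' ∧ L ⊆ L' ∧ ∀ a ∈ L', a ∈ L ∨ a = v ∨ ∃ b ∈ L', P u a b ∧ entry s.table u a = b + 1 := by
  induction n with
  | zero => intro x L L' _ h; simp [walk] at h
  | succ n ih =>
    intro x L L' hx h
    rw [walk] at h
    split at h
    · rename_i hxv
      obtain rfl := Nat.eq_of_beq_eq_true hxv
      simp only [Option.some.injEq] at h
      subst h
      refine ⟨by simp, by simp, fun a ha => ?_⟩
      rcases List.mem_cons.1 ha with rfl | ha
      · exact Or.inr (Or.inl rfl)
      · exact Or.inl ha
    · split at h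
      · cases h
      · rename_i y hy
        have hpos := hs.pos_of_entry hx hy
        obtain ⟨h1, h2, h3⟩ := ih y (x :: L) (hP.lt (hP.rot (hP.rot hpos))) h
        refine ⟨h2 (by simp), fun a ha => h2 (by simp [ha]), fun a ha => ?_⟩
        rcases h3 a ha with h' | h'
        · rcases List.mem_cons.1 h' with rfl | h'
          · exact Or.inr (Or.inr ⟨y, h1, hpos, hy⟩)
          · exact Or.inl h'
        · exact Or.inr h'

/-- A true arc is never rejected: a different recorded third vertex contradicts uniqueness, a
completed link already records the arc, and a cycle closed by it is the full link, whose missing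
neighbours fit the budget. -/
theorem addArc_spec {s : State} (hs : Completes P δ s) (hP : Model P δ) {u v w : ℕ}
    (h : P u v w) : ∃ s', addArc s u v w = some s' ∧ Completes P δ s' := by
  have hu := hP.lt h
  have hv := hP.lt (hP.rot h)
  have hw := hP.lt (hP.rot (hP.rot h))
  rw [addArc]
  split
  · rename_i x hx
    rw [hP.unique (hs.pos_of_entry hv hx) h]
    exact ⟨s, by simp, hs⟩
  rename_i h0
  split
  · rename_i hm
    have := hs.entry_of_mask (testBit_eq_true_of_land hm) h
    omega
  rename_i hm
  replace hm := testBit_eq_false_of_land hm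
  have hentry : ∀ {u' v'}, v' < 9 → entry (setEntry s.table u v (w + 1)) u' v' =
      if u' = u ∧ v' = v then w + 1 else entry s.table u' v' :=
    fun hv' => entry_setEntry h0 (by omega) hv hv'
  have hpos : ∀ {u' v' w'}, v' < 9 → entry (setEntry s.table u v (w + 1)) u' v' = w' + 1 →
      P u' v' w' := by
    intro u' v' w' hv' he
    rw [hentry hv'] at he
    split_ifs at he with hc
    · obtain ⟨rfl, rfl⟩ := hc
      obtain rfl : w = w' := by omega
      exact h
    · exact hs.pos_of_entry hv' he
  have hmask : ∀ {u'}, s.mask.testBit u' → ∀ {v' w'}, P u' v' w' →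
      entry (setEntry s.table u v (w + 1)) u' v' = w' + 1 := by
    intro u' hu' v' w' h'
    rw [hentry (hP.lt (hP.rot h')), if_neg]
    · exact hs.entry_of_mask hu' h'
    · rintro ⟨rfl, -⟩
      rw [hm] at hu'
      cases hu'
  split
  · exact ⟨_, rfl, hpos, hmask, hs.deficit⟩
  · rename_i L hL
    obtain ⟨h1, -, h3⟩ := walk_spec hs hP 9 w [] hw hL
    have hsucc : ∀ a ∈ L, ∃ b ∈ L, P u a b := by
      intro a ha
      rcases h3 a ha with h' | rfl | ⟨b, hb, h', -⟩
      · cases h'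
      · exact ⟨w, h1, h⟩
      · exact ⟨b, hb, h'⟩
    have hall : ∀ x y, P u x y → x ∈ L := fun x y hxy => hP.link L h1 hsucc hxy
    have hlen := hP.le_deficit hu L hall
    have hsum : s.deficit + (8 - L.length) + ∑ x ∈ (Finset.range 9).filter
        (fun x => ¬ (s.mask ||| 2 ^ u).testBit x), δ x ≤ 6 := by
      have := hs.deficit
      -- Completing `u` moves it out of the sum, replacing `δ u` by `8 - L.length`, which is no
      -- larger by `hlen`.
      have hsplit : (Finset.range 9).filter (fun x => ¬ s.mask.testBit x) =
          insert u ((Finset.range 9).filter (fun x => ¬ (s.mask ||| 2 ^ u).testBit x)) := by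
        ext x
        by_cases hx : u = x
        · subst hx; simp [hu, hm]
        · simp [Nat.testBit_two_pow, hx, Ne.symm hx]
      rw [hsplit, Finset.sum_insert (by simp)] at this
      omega
    split
    · rename_i hfalse
      exfalso
      have hrow : rowSubset s.table u L = true := by
        rw [rowSubset, List.all_eq_true]
        intro x hx
        rw [Bool.or_eq_true]
        by_cases hz : entry s.table u x = 0
        · left; rw [hz]; rfl
        · right
          obtain ⟨y, hy⟩ := Nat.exists_eq_succ_of_ne_zero hz
          exact List.any_eq_true.2 ⟨x, hall x y (hs.pos_of_entry (List.mem_range.1 hx) hy),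
            Nat.beq_refl x⟩
      rw [hrow, Bool.true_and] at hfalse
      have : Nat.ble (s.deficit + (8 - L.length)) 6 = true := Nat.ble_eq_true_of_le (by omega)
      rw [this] at hfalse
      cases hfalse
    · refine ⟨_, rfl, hpos, ?_, hsum⟩
      intro u' hu' v' w' h'
      by_cases hx : u = u'
      · subst hx
        have hv' := hP.lt (hP.rot h')
        simp only [hentry hv', true_and]
        split_ifs with hc
        · subst hc
          rw [hP.unique h h']
        · rcases h3 v' (hall _ _ h') with h'' | h'' | ⟨b, hb, h'', he⟩
          · cases h''
          · exact absurd h'' hc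
          · rw [he, hP.unique h'' h']
      · refine hmask ?_ h'
        simpa [Nat.testBit_two_pow, hx] using hu'

theorem addTriangle_spec {s : State} (hs : Completes P δ s) (hP : Model P δ) {u v w : ℕ}
    (h : P u v w) : ∃ s', addTriangle s u v w = some s' ∧ Completes P δ s' := by
  obtain ⟨s₁, e₁, hs₁⟩ := addArc_spec hs hP h
  obtain ⟨s₂, e₂, hs₂⟩ := addArc_spec hs₁ hP (hP.rot h)
  obtain ⟨s₃, e₃, hs₃⟩ := addArc_spec hs₂ hP (hP.rot (hP.rot h))
  exact ⟨s₃, by simp [addTriangle, e₁, e₂, e₃], hs₃⟩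

/-- The search keeps `v` a neighbour of `u`. At an unknown arc the true third vertex is among the
candidates, and its branch again has the model as a completion, so the search cannot refute every
branch. -/
theorem not_completes_of_refute (hP : Model P δ) (n : ℕ) :
    ∀ (s : State) (u v : ℕ), (∃ w, P u v w) → refute n s u v = true → ¬ Completes P δ s := by
  induction n with
  | zero => intro s u v _ h; simp [refute] at h
  | succ n ih =>
    rintro s u v ⟨w, hw⟩ h hs
    have hu := hP.lt hw
    have hv := hP.lt (hP.rot hw)
    have hw9 := hP.lt (hP.rot (hP.rot hw))
    rw [refute] at h
    split at h
    · refine ih s _ 0 (hP.full (Nat.succ_pos _) ?_) h hs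
      exact Nat.succ_lt_succ (Nat.mod_lt _ (by norm_num))
    · split at h
      · rename_i x hx
        obtain rfl := hP.unique (hs.pos_of_entry hv hx) hw
        exact ih s u _ (hP.exists_opposite (hP.rot (hP.rot hw))) h hs
      · have h' := List.all_eq_true.1 h w (List.mem_range.2 hw9)
        have h1 : Nat.beq u w = false := by
          have := (hP.ne (hP.rot (hP.rot hw))).symm
          rwa [← Bool.not_eq_true, Nat.beq_eq]
        have h2 : Nat.beq v w = false := by
          have := hP.ne (hP.rot hw)
          rwa [← Bool.not_eq_true, Nat.beq_eq]
        obtain ⟨s', hs', hc⟩ := addTriangle_spec hs hP hw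
        rw [h1, h2, hs'] at h'
        exact ih s' u w (hP.exists_opposite (hP.rot (hP.rot hw))) h' hc

theorem Model.not_star (hP : Model P δ) : ¬ ∀ i < 8, P 0 (i + 1) ((i + 1) % 8 + 1) := by
  intro hstar
  refine not_completes_of_refute hP 100 star 1 0 (hP.full (by norm_num) (by norm_num)) refute_star
    ⟨?_, ?_, ?_⟩
  · have hdec : ∀ u v w : Fin 9, entry star.table u v = w + 1 → ∃ i : Fin 8,
        (u.1 = 0 ∧ v.1 = i + 1 ∧ w.1 = (i + 1) % 8 + 1) ∨
        (v.1 = 0 ∧ w.1 = i + 1 ∧ u.1 = (i + 1) % 8 + 1) ∨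
        (w.1 = 0 ∧ u.1 = i + 1 ∧ v.1 = (i + 1) % 8 + 1) := by decide +kernel
    -- The table has at most `81 = 9 * 9` digits, so all further rows are empty.
    have hbound : ∀ u v, entry star.table u v ≠ 0 → u < 9 := by
      intro u v h
      by_contra hu
      refine h ?_
      rw [entry_eq, Nat.div_eq_of_lt]
      calc star.table < 16 ^ 81 := by decide +kernel
        _ ≤ 16 ^ (9 * u + v) := Nat.pow_le_pow_right (by norm_num) (by omega)
    have hbound' : ∀ u < 9, ∀ v < 9, entry star.table u v < 10 := by decide +kernel
    intro u v w hv he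
    have hu := hbound u v (by omega)
    have hw := hbound' u hu v hv
    obtain ⟨⟨i, hi⟩, h⟩ := hdec ⟨u, hu⟩ ⟨v, hv⟩ ⟨w, by omega⟩ he
    simp only at h
    obtain ⟨rfl, rfl, rfl⟩ | ⟨rfl, rfl, rfl⟩ | ⟨rfl, rfl, rfl⟩ := h
    · exact hstar i hi
    · exact hP.rot (hP.rot (hstar i hi))
    · exact hP.rot (hstar i hi)
  · intro u hu v w h
    obtain rfl : u = 0 := by
      have : Nat.testBit (2 ^ 0) u = true := hu
      rw [Nat.testBit_two_pow] at this
      simpa using (of_decide_eq_true this).symm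
    have hv := hP.lt (hP.rot h)
    have hv0 := hP.ne h
    obtain ⟨i, rfl⟩ : ∃ i, v = i + 1 := ⟨v - 1, by omega⟩
    rw [hP.unique h (hstar i (by omega))]
    have : ∀ i < 8, entry star.table 0 (i + 1) = (i + 1) % 8 + 1 + 1 := by decide +kernel
    exact this i (by omega)
  · refine le_trans ?_ hP.sum_deficit
    rw [show star.deficit = 0 from rfl, Nat.zero_add]
    exact Finset.sum_le_sum_of_subset (Finset.filter_subset _ _)

end NineVertexSearch

/-! ### Excluding nine vertices -/

namespace OrientedTriangulatedSurface

variable {V : Type*} [Fintype V] [DecidableEq V] (K : OrientedTriangulatedSurface V)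

/-- The neighbours of a vertex in their cyclic order. -/
theorem exists_link_enumeration {u x₀ : V} (hx₀ : K.Adj u x₀) : ∃ c : ℕ → V,
    (∀ k, K.Pos u (c k) (c (k + 1))) ∧
    (∀ w, K.Adj u w → ∃ k < (Finset.univ.filter fun w => K.Adj u w).card, c k = w) ∧
    c (Finset.univ.filter fun w => K.Adj u w).card = c 0 := by
  classical
  choose g hg using fun a : {w // K.Adj u w} => exists_pos a.2
  let F : {w // K.Adj u w} → {w // K.Adj u w} := fun a => ⟨g a, (hg a).adj'⟩
  have hF : ∀ a, K.Pos u a.1 (F a).1 := hg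
  have hinj : Function.Injective F := by
    intro a b hab
    have h1 := hF a
    rw [hab] at h1
    exact Subtype.ext (h1.unique_left (hF b))
  let x : {w // K.Adj u w} := ⟨x₀, hx₀⟩
  have hsurj : ∀ w : {w // K.Adj u w}, ∃ k, F^[k] x = w := by
    intro w
    have := link_induction (K := K) (u := u) (x := x₀)
      (S := Set.range fun k => (F^[k] x).1) (y := w.1) ?_ ⟨0, rfl⟩ ?_ w.2
    · obtain ⟨k, hk⟩ := this
      exact ⟨k, Subtype.ext hk⟩
    · rintro _ ⟨k, rfl⟩
      exact (F^[k] x).2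
    · rintro _ ⟨k, rfl⟩ z hz
      refine ⟨k + 1, ?_⟩
      simp only [Function.iterate_succ_apply']
      exact (hF _).unique hz
  have hpos : 0 < Function.minimalPeriod F x :=
    Function.minimalPeriod_pos_of_mem_periodicPts (hinj.mem_periodicPts x)
  have hlt : ∀ w : {w // K.Adj u w}, ∃ k < Function.minimalPeriod F x, F^[k] x = w := by
    intro w
    obtain ⟨k, hk⟩ := hsurj w
    exact ⟨k % Function.minimalPeriod F x, Nat.mod_lt _ hpos,
      by rw [Function.iterate_mod_minimalPeriod_eq, hk]⟩
  -- The successor permutation is transitive on the link, so the period of `x` is the degree of `u`.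
  have hcard : (Finset.univ.filter fun w => K.Adj u w).card = Function.minimalPeriod F x := by
    have h1 : (Finset.range (Function.minimalPeriod F x)).image (fun k => F^[k] x) =
        Finset.univ := by
      ext w
      simpa using hlt w
    have h2 := congrArg Finset.card h1
    rw [Finset.card_image_of_injOn, Finset.card_range, Finset.card_univ,
      Fintype.card_subtype] at h2
    · exact h2.symm
    · rw [Finset.coe_range]
      exact Function.iterate_injOn_Iio_minimalPeriod
  refine ⟨fun k => (F^[k] x).1, fun k => ?_, fun w hw => ?_, ?_⟩
  · simp only [Function.iterate_succ_apply']
    exact hF _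
  · obtain ⟨k, hk, h⟩ := hlt ⟨w, hw⟩
    exact ⟨k, hcard ▸ hk, congrArg Subtype.val h⟩
  · simp only [hcard, Function.iterate_minimalPeriod, Function.iterate_zero, id_eq]

/-- The degrees sum to `66 > 9 * 7`, so some vertex is adjacent to all others. Labelling it `0` and
its link `1, …, 8` in cyclic order gives a model of the search whose deficits sum to `72 - 66 = 6`.
-/
theorem card_ne_nine_of_hasGenus_two (hK : K.HasGenus 2) : Fintype.card V ≠ 9 := by
  classical
  intro hV
  have hsum : ∑ v, (Finset.univ.filter fun w => K.Adj v w).card = 66 := by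
    have := (K.hasGenus_iff 2).1 hK
    rw [← card_posTriples_eq_sum]
    omega
  have hle : ∀ v, (Finset.univ.filter fun w => K.Adj v w).card ≤ 8 := by
    intro v
    have := K.card_neighbors_lt v
    omega
  obtain ⟨v₀, hv₀⟩ : ∃ v, 8 ≤ (Finset.univ.filter fun w => K.Adj v w).card := by
    by_contra! h
    have := Finset.sum_le_card_nsmul Finset.univ
      (fun v => (Finset.univ.filter fun w => K.Adj v w).card) 7
      fun v _ => Nat.le_of_lt_succ (h v)
    rw [Finset.card_univ, hV, hsum] at this
    norm_num at this
  have hdeg : (Finset.univ.filter fun w => K.Adj v₀ w).card = 8 := le_antisymm (hle v₀) hv₀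
  have hadj : ∀ w, w ≠ v₀ → K.Adj v₀ w := by
    have h1 : (Finset.univ.filter fun w => K.Adj v₀ w) = Finset.univ.erase v₀ := by
      refine Finset.eq_of_subset_of_card_le (fun w hw => ?_) ?_
      · simp only [Finset.mem_filter, Finset.mem_univ, true_and] at hw
        simpa using hw.1.symm
      · rw [Finset.card_erase_of_mem (Finset.mem_univ _), Finset.card_univ, hV, hdeg]
    intro w hw
    have : w ∈ Finset.univ.erase v₀ := by simpa using hw
    rw [← h1] at this
    simpa using this
  obtain ⟨x₀, hx₀⟩ : ∃ x, K.Adj v₀ x := by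
    obtain ⟨x, hx⟩ := Finset.card_pos.1 (by omega : 0 < (Finset.univ.filter fun w => K.Adj v₀ w).card)
    exact ⟨x, by simpa using hx⟩
  obtain ⟨c, hc, hcsurj, hc0⟩ := K.exists_link_enumeration hx₀
  rw [hdeg] at hcsurj hc0
  obtain ⟨e, he0, he⟩ : ∃ e : ℕ → V, e 0 = v₀ ∧ ∀ k, e (k + 1) = c k :=
    ⟨fun n => Nat.casesOn n v₀ c, rfl, fun _ => rfl⟩
  have hsurj : ∀ v, ∃ n < 9, e n = v := by
    intro v
    by_cases hv : v = v₀
    · exact ⟨0, by norm_num, he0.trans hv.symm⟩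
    · obtain ⟨k, hk, h⟩ := hcsurj v (hadj v hv)
      exact ⟨k + 1, by omega, (he k).trans h⟩
  have hinj : Set.InjOn e (Finset.range 9) := by
    refine Finset.injOn_of_card_image_eq ?_
    rw [show (Finset.range 9).image e = Finset.univ from ?_, Finset.card_univ, hV,
      Finset.card_range]
    ext v
    simpa using hsurj v
  simp only [Finset.coe_range] at hinj
  have hmodel : NineVertexSearch.Model
      (fun u v w : ℕ => u < 9 ∧ v < 9 ∧ w < 9 ∧ K.Pos (e u) (e v) (e w))
      (fun u : ℕ => 8 - (Finset.univ.filter fun w : V => K.Adj (e u) w).card) := by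
    constructor
    · exact fun h => h.1
    · rintro u v w ⟨hu, hv, hw, h⟩
      exact ⟨hv, hw, hu, h.rot⟩
    · rintro u v w w' ⟨hu, hv, hw, h⟩ ⟨-, -, hw', h'⟩
      exact hinj hw hw' (h.unique h')
    · rintro u v w ⟨hu, hv, hw, h⟩ rfl
      exact h.adj.1 rfl
    · rintro u v w ⟨hu, hv, hw, h⟩
      obtain ⟨x, hx⟩ := exists_pos h.adj.symm
      obtain ⟨n, hn, rfl⟩ := hsurj x
      exact ⟨n, hv, hu, hn, hx⟩
    · rintro u S x y z hx hS ⟨hu, hy, hz, h⟩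
      have := link_induction (K := K) (u := e u) (x := e x) (y := e y)
        (S := {a | ∃ n ∈ S, e n = a}) ?_ ⟨x, hx, rfl⟩ ?_ h.adj
      · obtain ⟨n, hn, hne⟩ := this
        obtain ⟨b, -, -, hn9, -⟩ := hS n hn
        rwa [← hinj hn9 hy hne]
      · rintro _ ⟨n, hn, rfl⟩
        obtain ⟨b, -, -, -, -, hpos⟩ := hS n hn
        exact hpos.adj
      · rintro _ ⟨n, hn, rfl⟩ a ha
        obtain ⟨b, hb, -, -, -, hpos⟩ := hS n hn
        exact ⟨b, hb, hpos.unique ha⟩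
    · intro u hu S hS
      have : (Finset.univ.filter fun w : V => K.Adj (e u) w).card ≤ S.length := by
        refine le_trans (Finset.card_le_card (t := (S.map e).toFinset) fun w hw => ?_)
          ((List.toFinset_card_le _).trans (by simp))
        simp only [Finset.mem_filter, Finset.mem_univ, true_and] at hw
        obtain ⟨y, hy⟩ := exists_pos hw
        obtain ⟨n, hn, rfl⟩ := hsurj w
        obtain ⟨m, hm, rfl⟩ := hsurj y
        exact List.mem_toFinset.2 (List.mem_map_of_mem (hS n m ⟨hu, hn, hm, hy⟩))
      omega
    · have h1 : ∑ u ∈ Finset.range 9, (Finset.univ.filter fun w : V => K.Adj (e u) w).card = 66 := by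
        rw [← hsum]
        refine Finset.sum_bij (fun n _ => e n) (fun _ _ => Finset.mem_univ _) ?_ ?_ fun _ _ => rfl
        · intro a ha b hb h
          exact hinj (Finset.mem_range.1 ha) (Finset.mem_range.1 hb) h
        · intro v _
          obtain ⟨n, hn, h⟩ := hsurj v
          exact ⟨n, Finset.mem_range.2 hn, h⟩
      have h2 : ∑ u ∈ Finset.range 9, (8 - (Finset.univ.filter fun w : V => K.Adj (e u) w).card) +
          ∑ u ∈ Finset.range 9, (Finset.univ.filter fun w : V => K.Adj (e u) w).card = 72 := by
        rw [← Finset.sum_add_distrib, Finset.sum_congr rfl fun u _ => Nat.sub_add_cancel (hle (e u))]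
        simp
      omega
    · intro u hu0 hu
      have hne : e u ≠ v₀ := fun h => by
        have := hinj hu (show 0 < 9 by norm_num) (h.trans he0.symm)
        omega
      obtain ⟨x, hx⟩ := exists_pos (hadj _ hne).symm
      obtain ⟨n, hn, rfl⟩ := hsurj x
      exact ⟨n, hu, by norm_num, hn, he0.symm ▸ hx⟩
  refine hmodel.not_star fun i hi => ⟨by norm_num, by omega, by omega, ?_⟩
  rw [he0, he, he]
  rcases Nat.lt_or_ge (i + 1) 8 with h | h
  · rw [Nat.mod_eq_of_lt h]
    exact hc i
  -- The last triangle wraps around, as the enumeration satisfies `c 8 = c 0`.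
  · obtain rfl : i = 7 := by omega
    have := hc 7
    rw [hc0] at this
    exact this

theorem ten_le_card_of_hasGenus_two (hK : K.HasGenus 2) : 10 ≤ Fintype.card V := by
  have h1 := K.nine_le_card_of_hasGenus_two hK
  have h2 := K.card_ne_nine_of_hasGenus_two hK
  omega

end OrientedTriangulatedSurface

/-! ### Maps from the surface of a rotation system -/

theorem List.count_map_eq_sum {α β : Type*} [Fintype α] [DecidableEq α] [DecidableEq β]
    [BEq β] [LawfulBEq β] {l : List α} (hl : l.Nodup) (g : α → β) (b : β) :
    ((l.map g).count b : ℤ) = ∑ a, if g a = b ∧ a ∈ l then 1 else 0 := by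
  rw [List.count, List.countP_map, List.countP_eq_length_filter, ← List.toFinset_card_of_nodup
    (hl.filter _), Finset.sum_boole]
  congr 2
  ext a
  simp [and_comm]

namespace RotationSystem

variable {V : Type*} [Fintype V] [DecidableEq V] (R : RotationSystem V)

theorem surface_sign (u v w : V) : R.surface.sign u v w =
    (if (v, w) ∈ cycPairs (R.link u) then 1 else 0) -
      if (w, v) ∈ cycPairs (R.link u) then 1 else 0 := by
  have h : R.Pos v u w ↔ R.Pos u w v := ⟨fun h => h.rot, fun h => h.rot.rot⟩
  simp only [surface]
  by_cases h1 : R.Pos u v w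
  · have h2 := h1.not_swap
    have h1' := h1
    rw [Pos] at h1' h2
    simp [h1, h1', h2]
  · have h1' := h1
    rw [Pos] at h1'
    by_cases h2 : R.Pos u w v
    · have h2' := h2
      rw [Pos] at h2'
      simp [h1, h, h2, h1', h2']
    · have h2' := h2
      rw [Pos] at h2'
      simp [h1, h, h2, h1', h2']

/-- This form involves only the image lists at the vertices, so that for an explicit rotation system
the degree can be evaluated. -/
theorem chainMap₂_surface {W : Type*} [DecidableEq W] (f : V → W) (x y z : W) :
    chainMap₂ f R.surface.sign x y z = ∑ u, if f u = x then
      ((cycPairs ((R.link u).map f)).count (y, z) : ℤ) -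
        (cycPairs ((R.link u).map f)).count (z, y) else 0 := by
  rw [chainMap₂]
  refine Finset.sum_congr rfl fun u _ => ?_
  by_cases hu : f u = x
  · have hcount : ∀ y z, ((cycPairs ((R.link u).map f)).count (y, z) : ℤ) =
        ∑ v, ∑ w, if f v = y ∧ f w = z ∧ (v, w) ∈ cycPairs (R.link u) then 1 else 0 := by
      intro y z
      rw [cycPairs_map, List.count_map_eq_sum (nodup_cycPairs (R.nodup u)), Fintype.sum_prod_type]
      simp [and_assoc]
    rw [if_pos hu, hcount, hcount,
      Finset.sum_comm (f := fun v w => if f v = z ∧ f w = y ∧ _ then (1 : ℤ) else 0),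
      ← Finset.sum_sub_distrib]
    refine Finset.sum_congr rfl fun v _ => ?_
    rw [← Finset.sum_sub_distrib]
    refine Finset.sum_congr rfl fun w _ => ?_
    rw [surface_sign]
    by_cases hv : f v = y <;> by_cases hw : f w = z <;> simp [hu, hv, hw]
  · simp [hu]

/-- A map that, around every vertex `v`, is the `m v`-fold cover of the star of `f v` has as its
degree the number of preimages of any vertex, counted with multiplicity. -/
theorem hasDegree_of_local {f : V → Fin 7} {m : V → ℕ} {d : ℕ}
    (hloc : ∀ v y z, (cycPairs ((R.link v).map f)).count (y, z) =
      if TorusPositive (f v) y z then m v else 0)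
    (hd : ∀ x, ∑ v with f v = x, m v = d) : HasDegree R.surface torus₇ f d := by
  funext x y z
  rw [chainMap₂_surface]
  have hsign : torus₇.sign x y z =
      (if TorusPositive x y z then 1 else 0) - if TorusPositive x z y then 1 else 0 := by
    revert x y z
    decide +kernel
  simp only [Pi.smul_apply, smul_eq_mul, hsign, hloc]
  rw [← hd x, ← Finset.sum_filter, Nat.cast_sum, Finset.sum_mul]
  refine Finset.sum_congr rfl fun v hv => ?_
  simp only [Finset.mem_filter, Finset.mem_univ, true_and] at hv
  rw [hv]
  split_ifs <;> simp

theorem isSimplicialMap {W : Type*} [DecidableEq W] {L : AbstractSimplicialComplex W} {f : V → W}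
    (h : ∀ v, ∀ p ∈ cycPairs ((R.link v).map f), {f v, p.1, p.2} ∈ L.faces) :
    IsSimplicialMap R.surface.complex L f := by
  rintro s ⟨hs, v, a, b, hpos, hsub⟩
  have h' := h v (f a, f b) (by
    rw [cycPairs_map]
    exact List.mem_map_of_mem (f := Prod.map f f) hpos)
  refine (L.isRelLowerSet_faces h').2 ?_ (hs.image f)
  refine (Finset.image_subset_image hsub).trans ?_
  simp [Finset.image_insert]

theorem isSimplicialMap_of_local {f : V → Fin 7} {m : V → ℕ}
    (hloc : ∀ v y z, (cycPairs ((R.link v).map f)).count (y, z) =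
      if TorusPositive (f v) y z then m v else 0) :
    IsSimplicialMap R.surface.complex torus₇.complex f := by
  refine R.isSimplicialMap fun v p hp => ?_
  have h := hloc v p.1 p.2
  have hcount : 0 < (cycPairs ((R.link v).map f)).count (p.1, p.2) := List.count_pos_iff.2 hp
  have hpos : TorusPositive (f v) p.1 p.2 := by
    by_contra hneg
    rw [if_neg hneg] at h
    omega
  exact ((torusComplex_isTriangle_iff _ _ _).2 (Or.inl hpos)).2.2.2

/-- The degree of a vertex is the length of its list, which turns the genus into an arithmetic
condition. -/
theorem hasGenus_surface (g : ℕ)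
    (h : ∑ v, (R.link v).length + 12 = 6 * Fintype.card V + 12 * g) : R.surface.HasGenus g := by
  rw [OrientedTriangulatedSurface.hasGenus_iff,
    OrientedTriangulatedSurface.card_posTriples_eq_sum]
  have : ∀ v, (Finset.univ.filter fun w => R.surface.Adj v w).card = (R.link v).length := by
    intro v
    rw [← List.toFinset_card_of_nodup (R.nodup v)]
    congr 1
    ext w
    rw [Finset.mem_filter, List.mem_toFinset, ← adj_iff v w]
    exact and_iff_right (Finset.mem_univ w)
  rw [Finset.sum_congr rfl fun v _ => this v]
  exact_mod_cast h

end RotationSystem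

/-! ### Constant maps and reversal of orientation -/

theorem chainMap₂_const {V W : Type*} [Fintype V] [DecidableEq V] [DecidableEq W]
    (K : OrientedTriangulatedSurface V) (c : W) : chainMap₂ (fun _ => c) K.sign = 0 := by
  funext x y z
  have h : ∑ u, ∑ v, ∑ w, K.sign u v w = 0 := by
    have h1 : ∑ u, ∑ v, ∑ w, K.sign u v w = -∑ u, ∑ v, ∑ w, K.sign u v w := by
      conv_lhs => rw [Finset.sum_comm]
      simp only [← Finset.sum_neg_distrib]
      exact Finset.sum_congr rfl fun u _ => Finset.sum_congr rfl fun v _ =>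
        Finset.sum_congr rfl fun w _ => K.sign_swap_left u v w
    linarith
  simp only [chainMap₂, Pi.zero_apply]
  by_cases hc : c = x ∧ c = y ∧ c = z
  · simp only [if_pos hc, h]
  · simp only [if_neg hc, Finset.sum_const_zero]

theorem isSimplicialMap_const {V W : Type*} [DecidableEq W]
    (K : AbstractSimplicialComplex V) (L : AbstractSimplicialComplex W) (c : W) :
    IsSimplicialMap K L fun _ => c := by
  intro s hs
  rw [Finset.image_const (K.isRelLowerSet_faces hs).1]
  exact L.singleton_mem c

/-- The surface with the opposite orientation. -/
def OrientedTriangulatedSurface.reverse {V : Type*} [Fintype V] [DecidableEq V]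
    (K : OrientedTriangulatedSurface V) : OrientedTriangulatedSurface V where
  complex := K.complex
  isClosedSurface := K.isClosedSurface
  sign u v w := -K.sign u v w
  sign_of_isTriangle u v w h := by
    rcases K.sign_of_isTriangle u v w h with h | h <;> simp [h]
  sign_of_not_isTriangle u v w h := by simp [K.sign_of_not_isTriangle u v w h]
  sign_swap_left u v w := by rw [K.sign_swap_left]
  sign_swap_right u v w := by rw [K.sign_swap_right]
  coherent u v w w' hne h h' := by rw [K.coherent u v w w' hne h h']

theorem HasDegree.reverse {V W : Type*} [Fintype V] [DecidableEq V] [Fintype W] [DecidableEq W]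
    {K : OrientedTriangulatedSurface V} {L : OrientedTriangulatedSurface W} {f : V → W} {d : ℤ}
    (h : HasDegree K L f d) : HasDegree K.reverse L f (-d) := by
  rw [HasDegree] at h ⊢
  rw [neg_smul, ← h]
  funext x y z
  simp only [chainMap₂, OrientedTriangulatedSurface.reverse, Pi.neg_apply,
    ← Finset.sum_neg_distrib]
  refine Finset.sum_congr rfl fun u _ => Finset.sum_congr rfl fun v _ =>
    Finset.sum_congr rfl fun w _ => ?_
  split_ifs <;> simp

/-- There is a simplicial map of degree `d` from a surface of genus `g` with `n` vertices to the 7-vertex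
torus. -/
def ExistsDegreeMap (g n : ℕ) (d : ℤ) : Prop :=
  ∃ (V : Type) (_ : Fintype V) (_ : DecidableEq V) (K : OrientedTriangulatedSurface V)
    (f : V → Fin 7), Fintype.card V = n ∧ K.HasGenus g ∧
      IsSimplicialMap K.complex torus₇.complex f ∧ HasDegree K torus₇ f d

theorem ExistsDegreeMap.neg {g n : ℕ} {d : ℤ} (h : ExistsDegreeMap g n d) :
    ExistsDegreeMap g n (-d) := by
  obtain ⟨V, i, j, K, f, hn, hg, hf, hd⟩ := h
  exact ⟨V, i, j, K.reverse, f, hn, hg, hf, hd.reverse⟩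

theorem ExistsDegreeMap.of_natAbs {g n : ℕ} {d : ℤ} (h : ExistsDegreeMap g n d.natAbs) :
    ExistsDegreeMap g n d := by
  rcases Int.natAbs_eq d with hd | hd
  · rwa [hd]
  · rw [hd]
    exact h.neg

/-! ### Explicit surfaces of genus two -/

/-- A surface of genus two with ten vertices. -/
def genusTwoTen : RotationSystem (Fin 10) where
  link := ![[1, 9, 3, 6, 4, 7, 8, 2, 5], [0, 5, 7, 2, 8, 4, 9], [0, 8, 1, 7, 6, 3, 4, 5],
    [0, 9, 7, 4, 2, 6], [0, 6, 9, 1, 8, 5, 2, 3, 7], [0, 2, 4, 8, 7, 1], [0, 3, 2, 7, 9, 4],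
    [0, 4, 3, 9, 6, 2, 1, 5, 8], [0, 7, 5, 4, 1, 2], [0, 1, 4, 6, 7, 3]]
  nodup := by decide +kernel
  three_le := by decide +kernel
  not_mem := by decide +kernel
  rot := by decide +kernel
  root := 0
  rank := Fin.val
  exists_lower := by decide +kernel

theorem existsDegreeMap_two_ten_one : ExistsDegreeMap 2 10 1 := by
  -- The vertices `1, 2, 5, 8` are all sent to `1`; the other six fibres are single points.
  refine ⟨Fin 10, inferInstance, inferInstance, genusTwoTen.surface,
    ![0, 1, 1, 2, 4, 1, 6, 5, 1, 3], rfl, ?_, ?_, ?_⟩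
  · exact genusTwoTen.hasGenus_surface 2 (by decide +kernel)
  · exact genusTwoTen.isSimplicialMap
      (L := torusComplex) (f := ![0, 1, 1, 2, 4, 1, 6, 5, 1, 3]) (by decide +kernel)
  · funext x y z
    rw [genusTwoTen.chainMap₂_surface]
    revert x y z
    decide +kernel

theorem existsDegreeMap_two_ten_zero : ExistsDegreeMap 2 10 0 := by
  refine ⟨Fin 10, inferInstance, inferInstance, genusTwoTen.surface, fun _ => 0, rfl, ?_,
    isSimplicialMap_const _ _ _, ?_⟩
  · exact genusTwoTen.hasGenus_surface 2 (by decide +kernel)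
  · rw [HasDegree, chainMap₂_const, zero_smul]

/-- Two 7-vertex tori, glued crosswise along a slit of two edges, with a vertex added on one of the
two edges between the ends of the slit. -/
def genusTwoThirteen : RotationSystem (Fin 13) where
  link := ![[3, 2, 12, 4, 5, 1, 9, 8, 6, 10, 11, 7], [2, 4, 9, 0, 5, 6], [3, 5, 4, 1, 6, 12, 0],
    [6, 5, 2, 0, 7, 10], [5, 0, 12, 6, 9, 1, 2], [6, 1, 0, 4, 2, 3],
    [9, 4, 12, 2, 1, 5, 3, 10, 0, 8, 7, 11], [8, 10, 3, 0, 11, 6], [9, 11, 10, 7, 6, 0],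
    [6, 11, 8, 0, 1, 4], [11, 0, 6, 3, 7, 8], [6, 7, 0, 10, 8, 9], [0, 2, 6, 4]]
  nodup := by decide +kernel
  three_le := by decide +kernel
  not_mem := by decide +kernel
  rot := by decide +kernel
  root := 0
  rank := Fin.val
  exists_lower := by decide +kernel

theorem existsDegreeMap_two_thirteen_two : ExistsDegreeMap 2 13 2 := by
  -- The added vertex `12` is sent to the end `0` of its edge, so two of its four triangles
  -- degenerate. The slit ends `0` and `6` are shared by the two tori.
  refine ⟨Fin 13, inferInstance, inferInstance, genusTwoThirteen.surface,
    ![0, 1, 2, 3, 4, 5, 6, 1, 2, 3, 4, 5, 0], rfl, ?_, ?_, ?_⟩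
  · exact genusTwoThirteen.hasGenus_surface 2 (by decide +kernel)
  · exact genusTwoThirteen.isSimplicialMap (L := torusComplex)
      (f := ![0, 1, 2, 3, 4, 5, 6, 1, 2, 3, 4, 5, 0]) (by decide +kernel)
  · funext x y z
    rw [genusTwoThirteen.chainMap₂_surface]
    revert x y z
    decide +kernel

/-! ### Cyclic tori -/

/-- The neighbours of `0` in the triangulated plane `ℤ → ZMod N`, in their cyclic order. -/
def torusOffsets : List ℤ := [1, 3, 2, -1, -3, -2]

theorem torusOffsets_le {k : ℤ} (h : k ∈ torusOffsets) : |k| ≤ 3 ∧ k ≠ 0 := by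
  revert k
  decide +kernel

theorem torusOffsets_rot : ∀ p ∈ cycPairs torusOffsets,
    (p.2 - p.1, -p.1) ∈ cycPairs torusOffsets := by
  decide +kernel

theorem mem_cycPairs_offsets {A : Type*} [AddCommGroupWithOne A] (v : A) {p : A × A}
    (hp : p ∈ cycPairs (torusOffsets.map fun k : ℤ => v + (k : A))) :
    (p.2, v) ∈ cycPairs (torusOffsets.map fun k : ℤ => p.1 + (k : A)) := by
  rw [cycPairs_map] at hp ⊢
  obtain ⟨⟨a, b⟩, hab, rfl⟩ := List.mem_map.1 hp
  refine List.mem_map.2 ⟨_, torusOffsets_rot _ hab, ?_⟩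
  simp

/-- The vertices of the 7-vertex torus as residues modulo 7. -/
def torusVertex (a : ZMod 7) : Fin 7 := a

/-- Modulo seven the offsets are the link order of the 7-vertex torus, so reduction to `ZMod 7` is
an isomorphism on every star. -/
theorem count_cycPairs_offsets : ∀ (t : ZMod 7) (y z : Fin 7),
    (cycPairs (torusOffsets.map fun k : ℤ => torusVertex (t + (k : ZMod 7)))).count (y, z) =
      if TorusPositive (torusVertex t) y z then 1 else 0 := by
  decide +kernel

theorem intCast_zmod_inj {N : ℕ} {i j : ℤ} (h : |i - j| < N) (hij : (i : ZMod N) = j) : i = j := by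
  have h1 := (ZMod.intCast_eq_intCast_iff_dvd_sub j i N).1 hij.symm
  have := Int.eq_zero_of_abs_lt_dvd h1 h
  omega

/-- The triangulated torus with `N` vertices and a cyclic symmetry. -/
def cyclicTorus (N : ℕ) (hN : 7 ≤ N) : RotationSystem (ZMod N) where
  link v := torusOffsets.map fun k : ℤ => v + (k : ZMod N)
  nodup v := by
    refine List.Nodup.map_on (fun i hi j hj h => ?_) (by decide)
    -- Two offsets differ by at most six, so `N ≥ 7` keeps the neighbours distinct.
    refine intCast_zmod_inj ?_ (add_left_cancel h)
    have h1 := (torusOffsets_le hi).1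
    have h2 := (torusOffsets_le hj).1
    rw [abs_le] at h1 h2
    rw [abs_lt]
    omega
  three_le v := by simp [torusOffsets]
  not_mem v h := by
    obtain ⟨k, hk, hv⟩ := List.mem_map.1 h
    have h1 := torusOffsets_le hk
    refine h1.2 (intCast_zmod_inj (N := N) (j := 0) ?_ ?_)
    · rw [sub_zero]
      omega
    · rwa [add_eq_left, ← Int.cast_zero] at hv
  rot v p hp := mem_cycPairs_offsets v hp
  root := 0
  rank := ZMod.val
  exists_lower v hv := by
    have : NeZero N := ⟨by omega⟩
    refine ⟨v - 1, List.mem_map.2 ⟨-1, by decide, by simp [sub_eq_add_neg]⟩, ?_⟩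
    have hpos : v.val ≠ 0 := fun h => hv ((ZMod.val_eq_zero v).1 h)
    have : Fact (1 < N) := ⟨by omega⟩
    rw [ZMod.val_sub (by rw [ZMod.val_one]; omega), ZMod.val_one]
    omega

theorem card_fiber_castHom {N k : ℕ} [NeZero N] (h : N = 7 * k) (x : ZMod 7) :
    (Finset.univ.filter fun v : ZMod N => ZMod.castHom (Dvd.intro k h.symm) (ZMod 7) v = x).card =
      k := by
  set φ := ZMod.castHom (Dvd.intro k h.symm) (ZMod 7)
  have hsurj : Function.Surjective φ := ZMod.castHom_surjective _
  have hfib : ∀ x, (Finset.univ.filter fun v : ZMod N => φ v = x).card =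
      (Finset.univ.filter fun v : ZMod N => φ v = 0).card := by
    intro x
    obtain ⟨w, hw⟩ := hsurj x
    refine Finset.card_bij (fun v _ => v - w) ?_ ?_ ?_
    · intro v hv
      simp only [Finset.mem_filter, Finset.mem_univ, true_and] at hv ⊢
      rw [map_sub, hv, hw, sub_self]
    · intro a _ b _ hab
      exact sub_left_injective hab
    · intro b hb
      simp only [Finset.mem_filter, Finset.mem_univ, true_and] at hb
      refine ⟨b + w, ?_, add_sub_cancel_right b w⟩
      simp only [Finset.mem_filter, Finset.mem_univ, true_and]
      rw [map_add, hb, hw, zero_add]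
  have hsum : (Finset.univ : Finset (ZMod N)).card =
      ∑ x : ZMod 7, (Finset.univ.filter fun v : ZMod N => φ v = x).card :=
    Finset.card_eq_sum_card_fiberwise fun _ _ => Finset.mem_univ _
  rw [Finset.sum_congr rfl fun x _ => hfib x, Finset.sum_const, Finset.card_univ, Finset.card_univ,
    ZMod.card, ZMod.card, smul_eq_mul] at hsum
  rw [hfib]
  omega

/-- Reduction modulo seven is a simplicial covering with `d` sheets, and all degrees are six. -/
theorem existsDegreeMap_one {d : ℕ} (hd : d ≠ 0) : ExistsDegreeMap 1 (7 * d) d := by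
  have hN : 7 ≤ 7 * d := by omega
  have : NeZero (7 * d) := ⟨by omega⟩
  let φ := ZMod.castHom (Dvd.intro d rfl : 7 ∣ 7 * d) (ZMod 7)
  have hloc : ∀ v y z, (cycPairs (((cyclicTorus (7 * d) hN).link v).map fun v =>
      torusVertex (φ v))).count (y, z) = if TorusPositive (torusVertex (φ v)) y z then 1 else 0 := by
    intro v y z
    rw [← count_cycPairs_offsets (φ v) y z]
    congr 2
    simp [cyclicTorus, Function.comp_def]
  refine ⟨ZMod (7 * d), inferInstance, inferInstance, (cyclicTorus (7 * d) hN).surface,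
    fun v => torusVertex (φ v), ZMod.card _, ?_, ?_, ?_⟩
  · refine (cyclicTorus (7 * d) hN).hasGenus_surface 1 ?_
    simp [cyclicTorus, torusOffsets, ZMod.card, mul_comm]
  · exact (cyclicTorus (7 * d) hN).isSimplicialMap_of_local (m := fun _ => 1) hloc
  · refine (cyclicTorus (7 * d) hN).hasDegree_of_local (m := fun _ => 1) hloc fun x => ?_
    rw [Finset.sum_const, smul_eq_mul, mul_one]
    exact card_fiber_castHom rfl x

theorem existsDegreeMap_one_zero : ExistsDegreeMap 1 7 0 := by
  obtain ⟨V, i, j, K, f, hn, hg, hf, hd⟩ := existsDegreeMap_one one_ne_zero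
  refine ⟨V, i, j, K, fun _ => 0, hn, hg, isSimplicialMap_const _ _ _, ?_⟩
  rw [HasDegree, chainMap₂_const, zero_smul]

/-! ### Two cyclic tori glued along a slit -/

open Sum in
/-- The links of the surface obtained from a cyclic torus with vertices in `A` and the 7-vertex torus
by gluing them crosswise along the slit `0, 3, 6`. The ends `0` and `6` of the slit are
identified, `inl 3` and `inr 2` are the two copies of its midpoint, and `inr 0`, `inr 1`, `inr 3`,
`inr 4` are the vertices `1, 2, 4, 5` of the 7-vertex torus. -/
def slitLink (A : Type*) [AddGroupWithOne A] [DecidableEq A] : A ⊕ Fin 5 → List (A ⊕ Fin 5)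
  | inl v =>
    if v = (0 : ℤ) then
      [inl (3 : ℤ), inl (2 : ℤ), inl (-1 : ℤ), inl (-3 : ℤ), inl (-2 : ℤ), inl (1 : ℤ), inr 2,
        inr 1, inl (6 : ℤ), inr 3, inr 4, inr 0]
    -- On the side of the slit with the triangles `0 1 3`, `1 4 3`, `3 4 6`, the midpoint `3` is
    -- replaced by the copy `inr 2`. The links of the two ends join two hexagons into a cycle of
    -- length twelve.
    else if v = (1 : ℤ) then
      [inl (2 : ℤ), inl (4 : ℤ), inr 2, inl (0 : ℤ), inl (-2 : ℤ), inl (-1 : ℤ)]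
    else if v = (3 : ℤ) then
      [inl (6 : ℤ), inl (5 : ℤ), inl (2 : ℤ), inl (0 : ℤ), inr 0, inr 3]
    else if v = (4 : ℤ) then
      [inl (5 : ℤ), inl (7 : ℤ), inl (6 : ℤ), inr 2, inl (1 : ℤ), inl (2 : ℤ)]
    else if v = (6 : ℤ) then
      [inr 2, inl (4 : ℤ), inl (7 : ℤ), inl (9 : ℤ), inl (8 : ℤ), inl (5 : ℤ), inl (3 : ℤ), inr 3,
        inl (0 : ℤ), inr 1, inr 0, inr 4]
    else torusOffsets.map fun k : ℤ => inl (v + (k : A))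
  | inr i =>
    (![[inr 1, inr 3, inl (3 : ℤ), inl (0 : ℤ), inr 4, inl (6 : ℤ)],
      [inr 2, inr 4, inr 3, inr 0, inl (6 : ℤ), inl (0 : ℤ)],
      [inl (6 : ℤ), inr 4, inr 1, inl (0 : ℤ), inl (1 : ℤ), inl (4 : ℤ)],
      [inr 4, inl (0 : ℤ), inl (6 : ℤ), inl (3 : ℤ), inr 0, inr 1],
      [inl (6 : ℤ), inr 0, inl (0 : ℤ), inr 3, inr 1, inr 2]] : Fin 5 → List (A ⊕ Fin 5)) i

namespace SlitTorus

open Sum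

instance decidableMemList {α : Type*} [DecidableEq α] (a : α) (l : List α) : Decidable (a ∈ l) :=
  @List.instDecidableMemOfLawfulBEq α instBEqOfDecidableEq inferInstance a l

theorem slitLink_inl {A : Type*} [AddGroupWithOne A] [DecidableEq A] {v : A}
    (h0 : v ≠ (0 : ℤ)) (h1 : v ≠ (1 : ℤ)) (h3 : v ≠ (3 : ℤ)) (h4 : v ≠ (4 : ℤ))
    (h6 : v ≠ (6 : ℤ)) : slitLink A (inl v) = torusOffsets.map fun k : ℤ => inl (v + (k : A)) := by
  simp only [slitLink, if_neg h0, if_neg h1, if_neg h3, if_neg h4, if_neg h6]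

theorem slitLink_inl_int {i : ℤ} (h : i < 0 ∨ 6 < i) :
    slitLink ℤ (inl i) = torusOffsets.map fun k : ℤ => inl (i + k) := by
  simpa using slitLink_inl (A := ℤ) (v := i) (by simp; omega) (by simp; omega) (by simp; omega)
    (by simp; omega) (by simp; omega)

/-- Reduction of the first component modulo `M`. -/
def proj (M : ℕ) : ℤ ⊕ Fin 5 → ZMod M ⊕ Fin 5 := Sum.map (fun i : ℤ => (i : ZMod M)) id

/-- Integers in the range on which links are compatible with the reduction modulo `M`, and all
elements of the second component. -/
def InWindow (M : ℕ) : ℤ ⊕ Fin 5 → Prop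
  | inl i => -7 ≤ i ∧ i < M
  | inr _ => True

theorem intCast_eq_iff {M : ℕ} (hM : 14 ≤ M) {i k : ℤ} (h1 : -7 ≤ i) (h2 : i < M) (hk : 0 ≤ k)
    (hk' : k ≤ 6) : (i : ZMod M) = (k : ZMod M) ↔ i = k := by
  refine ⟨fun h => intCast_zmod_inj ?_ h, fun h => h ▸ rfl⟩
  rw [abs_lt]
  omega

/-- Inside the window only the integers `0, …, 6` themselves reduce to these residues: a difference
of at least `-7 - 6` exceeds `-M`. This reduces the axioms for `ZMod M` to an integer model that
does not depend on `M`. -/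
theorem slitLink_proj {M : ℕ} (hM : 14 ≤ M) {x : ℤ ⊕ Fin 5} (hx : InWindow M x) :
    slitLink (ZMod M) (proj M x) = (slitLink ℤ x).map (proj M) := by
  rcases x with i | i
  · obtain ⟨h1, h2⟩ := hx
    have key := fun k => intCast_eq_iff hM h1 h2 (k := k)
    simp only [proj, Sum.map_inl, slitLink, Int.cast_id]
    rw [if_congr (key 0 (by norm_num) (by norm_num)) rfl rfl,
      if_congr (key 1 (by norm_num) (by norm_num)) rfl rfl,
      if_congr (key 3 (by norm_num) (by norm_num)) rfl rfl,
      if_congr (key 4 (by norm_num) (by norm_num)) rfl rfl,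
      if_congr (key 6 (by norm_num) (by norm_num)) rfl rfl]
    split_ifs
    all_goals simp [Function.comp_def]
  · fin_cases i <;> simp [proj, slitLink]

/-- The range of the integers that occur in the link of a vertex. -/
theorem range_of_mem_slitLink {i j : ℤ} (h : inl j ∈ slitLink ℤ (inl i)) :
    (0 ≤ i ∧ i ≤ 6 ∧ -3 ≤ j ∧ j ≤ 9) ∨ (i - 3 ≤ j ∧ j ≤ i + 3) := by
  by_cases hi : i < 0 ∨ 6 < i
  · rw [slitLink_inl_int hi] at h
    obtain ⟨k, hk, hkj⟩ := List.mem_map.1 h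
    have := (torusOffsets_le hk).1
    rw [abs_le] at this
    have := inl_injective hkj
    omega
  · left
    have hdec : ∀ i ∈ Finset.Icc (0 : ℤ) 6, ∀ x ∈ slitLink ℤ (inl i),
        Sum.elim (fun j => decide (-3 ≤ j ∧ j ≤ 9)) (fun _ => true) x = true := by decide +kernel
    have := hdec i (Finset.mem_Icc.2 (by omega)) _ h
    simp only [Sum.elim_inl, decide_eq_true_eq] at this
    omega

theorem range_of_mem_slitLink_inr {i : Fin 5} {j : ℤ} (h : inl j ∈ slitLink ℤ (inr i)) :
    0 ≤ j ∧ j ≤ 6 := by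
  have hdec : ∀ i : Fin 5, ∀ x ∈ slitLink ℤ (inr i),
      Sum.elim (fun j => decide (0 ≤ j ∧ j ≤ 6)) (fun _ => true) x = true := by decide +kernel
  simpa using hdec i _ h

theorem nodup_slitLink (x : ℤ ⊕ Fin 5) : (slitLink ℤ x).Nodup := by
  rcases x with i | i
  · by_cases hi : i < 0 ∨ 6 < i
    · rw [slitLink_inl_int hi]
      refine List.Nodup.map (fun a b h => ?_) (by decide)
      have := inl_injective h
      omega
    · have hdec : ∀ i ∈ Finset.Icc (0 : ℤ) 6, (slitLink ℤ (inl i)).Nodup := by decide +kernel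
      exact hdec i (Finset.mem_Icc.2 (by omega))
  · revert i
    decide +kernel

theorem three_le_length (x : ℤ ⊕ Fin 5) : 3 ≤ (slitLink ℤ x).length := by
  rcases x with i | i
  · by_cases hi : i < 0 ∨ 6 < i
    · rw [slitLink_inl_int hi]
      simp [torusOffsets]
    · have hdec : ∀ i ∈ Finset.Icc (0 : ℤ) 6, 3 ≤ (slitLink ℤ (inl i)).length := by decide +kernel
      exact hdec i (Finset.mem_Icc.2 (by omega))
  · revert i
    decide +kernel

theorem not_mem_slitLink (x : ℤ ⊕ Fin 5) : x ∉ slitLink ℤ x := by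
  rcases x with i | i
  · by_cases hi : i < 0 ∨ 6 < i
    · rw [slitLink_inl_int hi]
      intro h
      obtain ⟨k, hk, hkj⟩ := List.mem_map.1 h
      have := (torusOffsets_le hk).2
      have := inl_injective hkj
      omega
    · have hdec : ∀ i ∈ Finset.Icc (0 : ℤ) 6, inl i ∉ slitLink ℤ (inl i) := by decide +kernel
      exact hdec i (Finset.mem_Icc.2 (by omega))
  · revert i
    decide +kernel

/-- Outside `[-3, 9]` a vertex and all its neighbours avoid the slit, and translation invariance
applies; a finite check covers the rest. -/
theorem rot_slitLink (x : ℤ ⊕ Fin 5) :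
    ∀ p ∈ cycPairs (slitLink ℤ x), (p.2, x) ∈ cycPairs (slitLink ℤ p.1) := by
  rcases x with i | i
  · by_cases hi : i < -3 ∨ 9 < i
    · intro p hp
      have hmap : ∀ j : ℤ, j < 0 ∨ 6 < j → slitLink ℤ (inl j) =
          (torusOffsets.map fun k : ℤ => j + (k : ℤ)).map inl := by
        intro j hj
        rw [slitLink_inl_int hj, List.map_map]
        rfl
      have hp1 := fst_mem_of_mem_cycPairs hp
      rw [hmap i (by omega)] at hp hp1
      obtain ⟨j, hj, hjp⟩ := List.mem_map.1 hp1
      obtain ⟨k, hk, rfl⟩ := List.mem_map.1 hj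
      have := (torusOffsets_le hk).1
      rw [abs_le] at this
      rw [← hjp, hmap _ (by omega), cycPairs_map]
      rw [cycPairs_map] at hp
      obtain ⟨⟨a, b⟩, hab, rfl⟩ := List.mem_map.1 hp
      obtain rfl : i + k = a := inl_injective hjp
      exact List.mem_map.2 ⟨(b, i), mem_cycPairs_offsets i hab, rfl⟩
    · have hdec : ∀ i ∈ Finset.Icc (-3 : ℤ) 9, ∀ p ∈ cycPairs (slitLink ℤ (inl i)),
          (p.2, inl i) ∈ cycPairs (slitLink ℤ p.1) := by decide +kernel
      exact hdec i (Finset.mem_Icc.2 (by omega))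
  · revert i
    decide +kernel

/-- Representatives in `[-3, M - 3)` leave room for steps of length three on either side within the
window. -/
theorem exists_proj_eq {M : ℕ} (hM : 14 ≤ M) (v : ZMod M ⊕ Fin 5) : ∃ x : ℤ ⊕ Fin 5,
    proj M x = v ∧ InWindow M x ∧ ∀ y ∈ slitLink ℤ x, InWindow M y := by
  have : NeZero M := ⟨by omega⟩
  rcases v with z | i
  · have hlt := ZMod.val_lt z
    obtain ⟨i, hi, h1, h2⟩ : ∃ i : ℤ, (i : ZMod M) = z ∧ -3 ≤ i ∧ i < M - 3 := by
      by_cases h : z.val + 3 < M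
      · exact ⟨z.val, by simp, by omega, by omega⟩
      · exact ⟨z.val - M, by simp, by omega, by omega⟩
    refine ⟨inl i, by simp [proj, hi], ⟨by omega, by omega⟩, ?_⟩
    rintro (j | j) hj
    · have := range_of_mem_slitLink hj
      exact ⟨by omega, by omega⟩
    · trivial
  · refine ⟨inr i, rfl, trivial, ?_⟩
    rintro (j | j) hj
    · have := range_of_mem_slitLink_inr hj
      exact ⟨by omega, by omega⟩
    · trivial

/-- A vertex and its neighbours span an integer range of length at most twelve, which is less than
`M`. -/
theorem proj_injOn {M : ℕ} (hM : 14 ≤ M) (x : ℤ ⊕ Fin 5) :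
    ∀ a ∈ x :: slitLink ℤ x, ∀ b ∈ x :: slitLink ℤ x, proj M a = proj M b → a = b := by
  intro a ha b hb hab
  rcases a with i | i <;> rcases b with j | j <;> simp only [proj, Sum.map_inl, Sum.map_inr] at hab
  · have hij := inl_injective hab
    rw [intCast_zmod_inj ?_ hij]
    rw [abs_lt]
    rcases x with k | k
    · have h1 : ∀ i, inl i ∈ inl k :: slitLink ℤ (inl k) →
          (0 ≤ k ∧ k ≤ 6 ∧ -3 ≤ i ∧ i ≤ 9) ∨ (k - 3 ≤ i ∧ i ≤ k + 3) := by
        intro i hi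
        rcases List.mem_cons.1 hi with h | h
        · have := inl_injective h
          omega
        · exact range_of_mem_slitLink h
      have := h1 i ha
      have := h1 j hb
      omega
    · have h1 : ∀ i, inl i ∈ inr k :: slitLink ℤ (inr k) → 0 ≤ i ∧ i ≤ 6 := by
        intro i hi
        rcases List.mem_cons.1 hi with h | h
        · cases h
        · exact range_of_mem_slitLink_inr h
      have := h1 i ha
      have := h1 j hb
      omega
  · cases hab
  · cases hab
  · exact congrArg inr (inr_injective hab)

/-- The surface of genus two glued from two tori along a slit. -/
def rotationSystem (M : ℕ) (hM : 14 ≤ M) : RotationSystem (ZMod M ⊕ Fin 5) where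
  link := slitLink (ZMod M)
  nodup v := by
    obtain ⟨x, rfl, hx, -⟩ := exists_proj_eq hM v
    rw [slitLink_proj hM hx]
    exact List.Nodup.map_on (fun a ha b hb => proj_injOn hM x a (List.mem_cons_of_mem _ ha) b
      (List.mem_cons_of_mem _ hb)) (nodup_slitLink x)
  three_le v := by
    obtain ⟨x, rfl, hx, -⟩ := exists_proj_eq hM v
    rw [slitLink_proj hM hx, List.length_map]
    exact three_le_length x
  not_mem v := by
    obtain ⟨x, rfl, hx, -⟩ := exists_proj_eq hM v
    rw [slitLink_proj hM hx]
    intro h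
    obtain ⟨y, hy, hyx⟩ := List.mem_map.1 h
    have := proj_injOn hM x y (List.mem_cons_of_mem _ hy) x List.mem_cons_self hyx
    exact not_mem_slitLink x (this ▸ hy)
  rot v := by
    obtain ⟨x, rfl, hx, hnbr⟩ := exists_proj_eq hM v
    rw [slitLink_proj hM hx, cycPairs_map]
    intro p hp
    obtain ⟨⟨a, b⟩, hab, rfl⟩ := List.mem_map.1 hp
    simp only [Prod.map_fst, Prod.map_snd]
    rw [slitLink_proj hM (hnbr a (fst_mem_of_mem_cycPairs hab)), cycPairs_map]
    exact List.mem_map.2 ⟨_, rot_slitLink x _ hab, rfl⟩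
  root := inl 0
  rank := Sum.elim ZMod.val fun _ => M
  -- On the cyclic torus the residue decreases along `-1`, or along a tabulated edge near the slit.
  -- The five extra vertices are all adjacent to `0`.
  exists_lower v hv := by
    have : NeZero M := ⟨by omega⟩
    rcases v with z | i
    · have hlt := ZMod.val_lt z
      have hpos : z.val ≠ 0 := fun h => hv (by rw [(ZMod.val_eq_zero z).1 h])
      obtain ⟨j, hj0, hjz, hj⟩ : ∃ j : ℤ, 0 ≤ j ∧ j < z.val ∧
          inl j ∈ slitLink ℤ (inl (z.val : ℤ)) := by
        by_cases hz : 6 < z.val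
        · refine ⟨z.val - 1, by omega, by omega, ?_⟩
          rw [slitLink_inl_int (by omega)]
          exact List.mem_map.2 ⟨-1, by decide, rfl⟩
        · have hdec : ∀ n ∈ Finset.Icc 1 6, ∃ j : Fin n, inl (j : ℤ) ∈ slitLink ℤ (inl (n : ℤ)) := by
            decide +kernel
          obtain ⟨j, hj⟩ := hdec z.val (Finset.mem_Icc.2 (by omega))
          exact ⟨(j : ℕ), by omega, by exact_mod_cast j.2, hj⟩
      have hproj : proj M (inl (z.val : ℤ)) = inl z := by simp [proj]
      refine ⟨proj M (inl j), ?_, ?_⟩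
      · rw [← hproj, slitLink_proj hM (x := inl (z.val : ℤ)) ⟨by omega, by omega⟩]
        exact List.mem_map_of_mem hj
      · obtain ⟨n, rfl⟩ := Int.eq_ofNat_of_zero_le hj0
        simp only [proj, Sum.map_inl, Sum.elim_inl, Int.cast_natCast]
        rw [ZMod.val_natCast, Nat.mod_eq_of_lt (by omega)]
        omega
    · refine ⟨inl 0, ?_, ?_⟩
      · have hdec : ∀ i : Fin 5, (inl 0 : ℤ ⊕ Fin 5) ∈ slitLink ℤ (inr i) := by decide +kernel
        have h := List.mem_map_of_mem (f := proj M) (hdec i)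
        rw [← slitLink_proj hM (x := inr i) trivial] at h
        simpa [proj] using h
      · simp only [Sum.elim_inl, Sum.elim_inr, ZMod.val_zero]
        omega

/-- The projection to the 7-vertex torus. -/
def toTorus {M k : ℕ} (h : M = 7 * k) : ZMod M ⊕ Fin 5 → Fin 7 :=
  Sum.elim (fun z => torusVertex (ZMod.castHom (Dvd.intro k h.symm) (ZMod 7) z))
    fun i => torusVertex ((i : ℕ) + 1)

/-- The multiplicity of the projection: the ends of the slit are branch points. -/
def multiplicity (A : Type*) [AddGroupWithOne A] [DecidableEq A] : A ⊕ Fin 5 → ℕ :=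
  Sum.elim (fun v => (if v = (0 : ℤ) then 2 else 1) + if v = (6 : ℤ) then 1 else 0) fun _ => 1

theorem multiplicity_proj {M : ℕ} (hM : 14 ≤ M) {x : ℤ ⊕ Fin 5} (hx : InWindow M x) :
    multiplicity (ZMod M) (proj M x) = multiplicity ℤ x := by
  rcases x with i | i
  · obtain ⟨h1, h2⟩ := hx
    simp only [multiplicity, proj, Sum.map_inl, Sum.elim_inl, Int.cast_id,
      intCast_eq_iff hM h1 h2 (k := 0) (by norm_num) (by norm_num),
      intCast_eq_iff hM h1 h2 (k := 6) (by norm_num) (by norm_num)]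
  · rfl

theorem count_toTorus {M k : ℕ} (h : M = 7 * k) (hM : 14 ≤ M) (v : ZMod M ⊕ Fin 5) (y z : Fin 7) :
    (cycPairs (((rotationSystem M hM).link v).map (toTorus h))).count (y, z) =
      if TorusPositive (toTorus h v) y z then multiplicity (ZMod M) v else 0 := by
  obtain ⟨x, rfl, hx, -⟩ := exists_proj_eq hM v
  let g : ℤ ⊕ Fin 5 → Fin 7 :=
    Sum.elim (fun i => torusVertex (i : ZMod 7)) fun i => torusVertex ((i : ℕ) + 1)
  have hg : ∀ x, toTorus h (proj M x) = g x := by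
    rintro (i | i)
    · simp only [toTorus, proj, g, Sum.map_inl, Sum.elim_inl, map_intCast]
    · rfl
  change (cycPairs ((slitLink (ZMod M) (proj M x)).map (toTorus h))).count (y, z) = _
  rw [slitLink_proj hM hx, List.map_map, multiplicity_proj hM hx, hg, show toTorus h ∘ proj M = g from funext hg]
  clear hx
  rcases x with i | i
  · by_cases hi : i < 0 ∨ 6 < i
    · have hm : multiplicity ℤ (inl i) = 1 := by
        simp only [multiplicity, Sum.elim_inl, Int.cast_id]
        rw [if_neg (by omega), if_neg (by omega)]
      rw [slitLink_inl_int hi, hm, List.map_map]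
      refine Eq.trans ?_ (count_cycPairs_offsets (i : ZMod 7) y z)
      congr 3
      funext k
      simp [g]
    · have hdec : ∀ i ∈ Finset.Icc (0 : ℤ) 6, ∀ y z : Fin 7,
          (cycPairs ((slitLink ℤ (inl i)).map g)).count (y, z) =
          if TorusPositive (g (inl i)) y z then multiplicity ℤ (inl i) else 0 := by
        decide +kernel
      exact hdec i (Finset.mem_Icc.2 (by omega)) y z
  · revert i y z
    decide +kernel

/-- The cyclic torus contributes `k` points to each fibre. The extra sheet contributes one of the
five added vertices, or the second multiplicity of a branch point over `0` and `6`. -/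
theorem sum_multiplicity {M k : ℕ} (h : M = 7 * k) (hM : 14 ≤ M) [NeZero M] (x : Fin 7) :
    ∑ v with toTorus h v = x, multiplicity (ZMod M) v = k + 1 := by
  have h60 : ((6 : ℤ) : ZMod M) ≠ ((0 : ℤ) : ZMod M) := by
    intro h6
    have := intCast_zmod_inj (N := M) (i := 6) (j := 0) (by norm_num; omega) h6
    omega
  have hm : ∀ z : ZMod M, multiplicity (ZMod M) (inl z) =
      1 + (if z = (0 : ℤ) then 1 else 0) + if z = (6 : ℤ) then 1 else 0 := by
    intro z
    simp only [multiplicity, Sum.elim_inl]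
    split_ifs <;> rfl
  have hcard := card_fiber_castHom h x
  rw [Finset.sum_filter, Fintype.sum_sum_type]
  have hfin : ∑ i : Fin 5, (if toTorus h (inr i) = x then multiplicity (ZMod M) (inr i) else 0) =
      if x = 0 ∨ x = 6 then 0 else 1 := by
    change ∑ i : Fin 5, (if torusVertex ((i : ℕ) + 1) = x then 1 else 0) = _
    clear hcard
    revert x
    decide +kernel
  have hz : ∑ z : ZMod M, (if toTorus h (inl z) = x then multiplicity (ZMod M) (inl z) else 0) =
      k + (if x = 0 then 1 else 0) + if x = 6 then 1 else 0 := by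
    have e : ∀ z : ZMod M, (if toTorus h (inl z) = x then multiplicity (ZMod M) (inl z) else 0) =
        (if toTorus h (inl z) = x then 1 else 0) +
        (if z = (0 : ℤ) then if toTorus h (inl z) = x then 1 else 0 else 0) +
        (if z = (6 : ℤ) then if toTorus h (inl z) = x then 1 else 0 else 0) := by
      intro z
      rw [hm]
      split_ifs <;> rfl
    have e0 : toTorus h (inl ((0 : ℤ) : ZMod M)) = 0 := by simp [toTorus]; rfl
    have e6 : toTorus h (inl ((6 : ℤ) : ZMod M)) = 6 := by
      simp only [toTorus, Sum.elim_inl, map_intCast]; rfl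
    rw [Finset.sum_congr rfl fun z _ => e z, Finset.sum_add_distrib, Finset.sum_add_distrib,
      Finset.sum_ite_eq' Finset.univ, Finset.sum_ite_eq' Finset.univ, e0, e6,
      ← Finset.card_filter, show (Finset.univ.filter fun z => toTorus h (inl z) = x).card = k from
        hcard]
    simp only [Finset.mem_univ, if_true, @eq_comm _ _ x]
  rw [hfin, hz]
  by_cases h0 : x = 0
  · subst h0; simp
  · by_cases h6 : x = 6
    · subst h6; simp
    · simp [h0, h6]

theorem length_slitLink (x : ℤ ⊕ Fin 5) : (slitLink ℤ x).length = 6 * multiplicity ℤ x := by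
  rcases x with i | i
  · by_cases hi : i < 0 ∨ 6 < i
    · rw [slitLink_inl_int hi]
      simp only [multiplicity, Sum.elim_inl, Int.cast_id]
      rw [if_neg (by omega), if_neg (by omega)]
      simp [torusOffsets]
    · have hdec : ∀ i ∈ Finset.Icc (0 : ℤ) 6,
          (slitLink ℤ (inl i)).length = 6 * multiplicity ℤ (inl i) := by decide +kernel
      exact hdec i (Finset.mem_Icc.2 (by omega))
  · revert i
    decide +kernel

theorem sum_length_slitLink {M k : ℕ} (h : M = 7 * k) (hM : 14 ≤ M) [NeZero M] :
    ∑ v, ((rotationSystem M hM).link v).length = 6 * M + 42 := by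
  have hlen : ∀ v, ((rotationSystem M hM).link v).length = 6 * multiplicity (ZMod M) v := by
    intro v
    obtain ⟨x, rfl, hx, -⟩ := exists_proj_eq hM v
    change (slitLink (ZMod M) (proj M x)).length = _
    rw [slitLink_proj hM hx, List.length_map, length_slitLink, multiplicity_proj hM hx]
  rw [Finset.sum_congr rfl fun v _ => hlen v, ← Finset.mul_sum,
    ← Finset.sum_fiberwise (s := Finset.univ) (g := toTorus h),
    Finset.sum_congr rfl fun x _ => sum_multiplicity h hM x, Finset.sum_const, Finset.card_univ,
    Fintype.card_fin, smul_eq_mul]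
  omega

end SlitTorus

/-! ### Realisation and minimality -/

/-- The large torus carries `d - 1` sheets and the small one the last. The bound `d ≥ 3` gives `7(d
- 1) ≥ 14`, so the ends `0` and `6` of the slit are not adjacent in the large torus and the gluing
creates no double edge. -/
theorem existsDegreeMap_two {d : ℕ} (hd : 3 ≤ d) : ExistsDegreeMap 2 (7 * d - 2) d := by
  obtain ⟨k, rfl⟩ : ∃ k, d = k + 1 := ⟨d - 1, by omega⟩
  have hM : 14 ≤ 7 * k := by omega
  have : NeZero (7 * k) := ⟨by omega⟩
  have hcard : Fintype.card (ZMod (7 * k) ⊕ Fin 5) = 7 * k + 5 := by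
    rw [Fintype.card_sum, ZMod.card, Fintype.card_fin]
  refine ⟨ZMod (7 * k) ⊕ Fin 5, inferInstance, inferInstance,
    (SlitTorus.rotationSystem _ hM).surface, SlitTorus.toTorus rfl, ?_, ?_, ?_, ?_⟩
  · omega
  · refine (SlitTorus.rotationSystem _ hM).hasGenus_surface 2 ?_
    rw [hcard, SlitTorus.sum_length_slitLink rfl]
    ring
  · exact (SlitTorus.rotationSystem _ hM).isSimplicialMap_of_local
      (SlitTorus.count_toTorus rfl hM)
  · exact (SlitTorus.rotationSystem _ hM).hasDegree_of_local (SlitTorus.count_toTorus rfl hM)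
      (SlitTorus.sum_multiplicity rfl hM)

theorem ExistsDegreeMap.isMinimal {g n : ℕ} {d : ℤ} (h : ExistsDegreeMap g n d)
    (hmin : ∀ (V : Type) [Fintype V] [DecidableEq V] (K : OrientedTriangulatedSurface V)
      (f : V → Fin 7), K.HasGenus g → HasDegree K torus₇ f d → n ≤ Fintype.card V) :
    ∃ (V : Type) (_ : Fintype V) (_ : DecidableEq V) (K : OrientedTriangulatedSurface V)
      (f : V → Fin 7), IsMinimalDegreeMap g d K f ∧ Fintype.card V = n := by
  obtain ⟨V, i, j, K, f, hn, hg, hf, hd⟩ := h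
  refine ⟨V, i, j, K, f, ⟨hg, hf, hd, fun V' _ _ K' f' hg' _ hd' => ?_⟩, hn⟩
  rw [hn]
  exact hmin V' K' f' hg' hd'

theorem corollary3p3 :
    (∀ d : ℤ, ∃ (V : Type) (_ : Fintype V) (_ : DecidableEq V)
      (K : OrientedTriangulatedSurface V) (f : V → Fin 7),
      IsMinimalDegreeMap 1 d K f ∧
      (d = 0 → Fintype.card V = 7) ∧
      (d ≠ 0 → Fintype.card V = 7 * d.natAbs)) ∧
    (∀ d : ℤ, ∃ (V : Type) (_ : Fintype V) (_ : DecidableEq V)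
      (K : OrientedTriangulatedSurface V) (f : V → Fin 7),
      IsMinimalDegreeMap 2 d K f ∧
      (d.natAbs ≤ 1 → Fintype.card V = 10) ∧
      (d.natAbs = 2 → Fintype.card V = 13) ∧
      (3 ≤ d.natAbs → Fintype.card V + 2 = 7 * d.natAbs)) := by
  constructor
  · intro d
    by_cases hd : d = 0
    · subst hd
      obtain ⟨V, i, j, K, f, hK, hn⟩ := existsDegreeMap_one_zero.isMinimal
        fun V _ _ K f hg _ => K.seven_le_card_of_hasGenus_one hg
      exact ⟨V, i, j, K, f, hK, fun _ => hn, fun h => absurd rfl h⟩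
    · obtain ⟨V, i, j, K, f, hK, hn⟩ :=
        (existsDegreeMap_one (Int.natAbs_ne_zero.2 hd)).of_natAbs.isMinimal
          fun V _ _ K f hg hf => K.seven_mul_natAbs_le_of_hasGenus_one hg hf
      exact ⟨V, i, j, K, f, hK, fun h => absurd h hd, fun _ => hn⟩
  · intro d
    rcases lt_trichotomy d.natAbs 2 with h | h | h
    · have hex : ExistsDegreeMap 2 10 d := by
        refine .of_natAbs ?_
        obtain h | h : d.natAbs = 0 ∨ d.natAbs = 1 := by omega
        · rw [h]
          exact existsDegreeMap_two_ten_zero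
        · rw [h]
          exact existsDegreeMap_two_ten_one
      obtain ⟨V, i, j, K, f, hK, hn⟩ := hex.isMinimal
        fun V _ _ K f hg _ => K.ten_le_card_of_hasGenus_two hg
      exact ⟨V, i, j, K, f, hK, fun _ => hn, by omega, by omega⟩
    · have hex : ExistsDegreeMap 2 13 d := by
        refine .of_natAbs ?_
        rw [h]
        exact existsDegreeMap_two_thirteen_two
      obtain ⟨V, i, j, K, f, hK, hn⟩ := hex.isMinimal
        fun V _ _ K f _ hf => K.thirteen_le_card h hf
      exact ⟨V, i, j, K, f, hK, by omega, fun _ => hn, by omega⟩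
    · obtain ⟨V, i, j, K, f, hK, hn⟩ := (existsDegreeMap_two h).of_natAbs.isMinimal
        fun V _ _ K f hg hf => by
          have := K.seven_mul_natAbs_le_of_hasGenus_two hg hf
          omega
      exact ⟨V, i, j, K, f, hK, by omega, by omega, by omega⟩
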